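/- **Theorem (Bayesian MSE of the reward estimate).** Let $K,d,d',n$ be natural numbers, let $\phi:\mathcal X\to\mathbb R^d$ be a measurable feature map on a measurable space of contexts, let $\sigma>0$, $\mu\in\mathbb R^{d'}$, $W_a\in\mathbb R^{d\times d'}$ for $a\in[K]$, and let $\Sigma\in\mathbb R^{d'\times d'}$ and $\Sigma_a\in\mathbb R^{d\times d}$, $a\in[K]$, be positive definite. For $\theta=(\theta_a)_{a\in[K]}$ let $r(x,a;\theta)=\phi(x)^\top\theta_a$ be the mean of the reward distribution $\mathcal N(\phi(x)^\top\theta_a,\sigma^2)$, and write $\|v\|_M=\sqrt{v^\top M v}$. Assume well-specified priors. That is, the latent parameter $\psi$, the true action parameters $\theta_*=(\theta_{*,a})_{a\in[K]}$ and the sample $S=(X_i,A_i,R_i)_{i\in[n]}$, with $X_i\in\mathcal X$, $A_i\in[K]$ and $R_i\in\mathbb R$, satisfy the following: * $\psi\sim\mathcal N(\mu,\Sigma)$; * given $\psi$, the $\theta_{*,a}$ are independent with $\theta_{*,a}\mid\psi\sim\mathcal N(W_a\psi,\Sigma_a)$; * $(X_i,A_i)_{i\in[n]}$ is independent of $(\psi,\theta_*)$;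 * given $\psi$, $\theta_*$ and $(X_i,A_i)_{i\in[n]}$, the rewards $R_i$ are independent with $R_i\sim\mathcal N(\phi(X_i)^\top\theta_{*,A_i},\sigma^2)$. Define $$G_a=\sigma^{-2}\sum_{i:A_i=a}\phi(X_i)\phi(X_i)^\top,\qquad B_a=\sigma^{-2}\sum_{i:A_i=a}R_i\,\phi(X_i),\qquad \tilde\Sigma_a=(\Sigma_a^{-1}+G_a)^{-1},$$ $$\bar\Sigma=\Big(\Sigma^{-1}+\sum_{a}W_a^\top\big(\Sigma_a^{-1}-\Sigma_a^{-1}\tilde\Sigma_a\Sigma_a^{-1}\big)W_a\Big)^{-1},\qquad \bar\mu=\bar\Sigma\Big(\Sigma^{-1}\mu+\sum_a W_a^\top\Sigma_a^{-1}\tilde\Sigma_aB_a\Big),$$ $$\hat\mu_a=\tilde\Sigma_a\big(B_a+\Sigma_a^{-1}W_a\bar\mu\big),\qquad \hat\Sigma_a=\tilde\Sigma_a+\tilde\Sigma_a\Sigma_a^{-1}W_a\bar\Sigma W_a^\top\Sigma_a^{-1}\tilde\Sigma_a,$$ and let $\hat r(x,a)=\phi(x)^\top\hat\mu_a$ be the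 direct-method reward estimate. Then for all $x\in\mathcal X$ and $a\in[K]$: 1. $\hat\Sigma_a$ is positive definite for every value of the sample, and $\theta_{*,a}\mid S\sim\mathcal N(\hat\mu_a,\hat\Sigma_a)$ almost surely; 2. $\phi(x)^\top\theta_{*,a}\mid S\sim\mathcal N\big(\phi(x)^\top\hat\mu_a,\ \|\phi(x)\|_{\hat\Sigma_a}^2\big)$ almost surely; 3. the Bayesian mean squared error, with the expectation taken over both $S$ and $\theta_*$, is finite and satisfies $$\mathbb E\big[(\hat r(x,a)-r(x,a;\theta_*))^2\big]=\mathbb E\big[\|\phi(x)\|_{\hat\Sigma_a}^2\big]<\infty.$$ -/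

import Mathlib

open MeasureTheory ProbabilityTheory

noncomputable section

namespace StructuredBandit

/-- The known quantities of the structured linear-Gaussian contextual bandit with contexts in `𝒳`,
actions `Fin K`, action parameters in `ℝ^d` and a latent parameter in `ℝ^d'`:
`ψ ∼ N(μ, Σ)`, `θ_a ∣ ψ ∼ N(W_a ψ, Σ_a)`, `R ∣ ψ, θ, X, A ∼ N(φ(X)ᵀ θ_A, σ²)`. -/
structure Model (𝒳 : Type*) [MeasurableSpace 𝒳] (K d d' : ℕ) where
  /-- feature map `φ` -/
  φ : 𝒳 → EuclideanSpace ℝ (Fin d)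
  measurable_φ : Measurable φ
  /-- reward noise standard deviation `σ` -/
  σ : ℝ
  σ_pos : 0 < σ
  /-- latent prior mean `μ` -/
  μ : EuclideanSpace ℝ (Fin d')
  /-- latent prior covariance `Σ` -/
  latentCov : Matrix (Fin d') (Fin d') ℝ
  posDef_latentCov : latentCov.PosDef
  /-- mixing matrices `W_a` -/
  W : Fin K → Matrix (Fin d) (Fin d') ℝ
  /-- conditional prior covariances `Σ_a` -/
  actionCov : Fin K → Matrix (Fin d) (Fin d) ℝ
  posDef_actionCov : ∀ a, (actionCov a).PosDef

/-- The weighted norm `‖v‖_M = √(vᵀ M v)`. -/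
def weightedNorm {d : ℕ} (M : Matrix (Fin d) (Fin d) ℝ) (v : EuclideanSpace ℝ (Fin d)) : ℝ :=
  Real.sqrt (v.ofLp ⬝ᵥ M.mulVec v.ofLp)

/-- Samples `S = (X_i, A_i, R_i)_{i ∈ [n]}`. -/
abbrev Sample (𝒳 : Type*) (K n : ℕ) : Type _ := Fin n → 𝒳 × Fin K × ℝ

namespace Model

variable {𝒳 : Type*} [MeasurableSpace 𝒳] {K d d' : ℕ} (M : Model 𝒳 K d d')

/-- The reward distribution `p(· ∣ x; θ_a) = N(φ(x)ᵀ θ_a, σ²)`. -/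
def rewardLaw (x : 𝒳) (θa : EuclideanSpace ℝ (Fin d)) : Measure ℝ :=
  gaussianReal ((M.φ x).ofLp ⬝ᵥ θa.ofLp) (M.σ ^ 2).toNNReal

/-- The reward function `r(x, a; θ)`: the mean reward of action `a` in context `x`. -/
def reward (x : 𝒳) (a : Fin K) (θ : Fin K → EuclideanSpace ℝ (Fin d)) : ℝ :=
  ∫ r, r ∂(M.rewardLaw x (θ a))

section Posterior

variable {n : ℕ} (s : Sample 𝒳 K n)

/-- `G_a = σ⁻² ∑_{i : A_i = a} φ(X_i) φ(X_i)ᵀ`. -/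
def G (a : Fin K) : Matrix (Fin d) (Fin d) ℝ :=
  (M.σ ^ 2)⁻¹ • ∑ i, if (s i).2.1 = a then
    Matrix.vecMulVec (M.φ (s i).1).ofLp (M.φ (s i).1).ofLp else 0

/-- `B_a = σ⁻² ∑_{i : A_i = a} R_i φ(X_i)`. -/
def B (a : Fin K) : Fin d → ℝ :=
  (M.σ ^ 2)⁻¹ • ∑ i, if (s i).2.1 = a then (s i).2.2 • (M.φ (s i).1).ofLp else 0

/-- `Σ̃_a = (Σ_a⁻¹ + G_a)⁻¹`, the covariance of `θ_a` given `ψ` and `S`. -/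
def condCov (a : Fin K) : Matrix (Fin d) (Fin d) ℝ :=
  ((M.actionCov a)⁻¹ + M.G s a)⁻¹

/-- `Σ̄ = (Σ⁻¹ + ∑_a W_aᵀ (Σ_a⁻¹ - Σ_a⁻¹ Σ̃_a Σ_a⁻¹) W_a)⁻¹`, the covariance of `ψ` given `S`. -/
def latentPostCov : Matrix (Fin d') (Fin d') ℝ :=
  (M.latentCov⁻¹ + ∑ a, (M.W a).transpose *
    ((M.actionCov a)⁻¹ - (M.actionCov a)⁻¹ * M.condCov s a * (M.actionCov a)⁻¹) * M.W a)⁻¹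

/-- `μ̄ = Σ̄ (Σ⁻¹ μ + ∑_a W_aᵀ Σ_a⁻¹ Σ̃_a B_a)`, the mean of `ψ` given `S`. -/
def latentPostMean : Fin d' → ℝ :=
  (M.latentPostCov s).mulVec (M.latentCov⁻¹.mulVec M.μ.ofLp +
    ∑ a, ((M.W a).transpose * (M.actionCov a)⁻¹ * M.condCov s a).mulVec (M.B s a))

/-- `μ̂_a = Σ̃_a (B_a + Σ_a⁻¹ W_a μ̄)`, the action posterior mean. -/
def postMean (a : Fin K) : EuclideanSpace ℝ (Fin d) :=
  WithLp.toLp 2 ((M.condCov s a).mulVec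
    (M.B s a + ((M.actionCov a)⁻¹ * M.W a).mulVec (M.latentPostMean s)))

/-- `Σ̂_a = Σ̃_a + Σ̃_a Σ_a⁻¹ W_a Σ̄ W_aᵀ Σ_a⁻¹ Σ̃_a`, the action posterior covariance. -/
def postCov (a : Fin K) : Matrix (Fin d) (Fin d) ℝ :=
  M.condCov s a + M.condCov s a * (M.actionCov a)⁻¹ * M.W a * M.latentPostCov s *
    (M.W a).transpose * (M.actionCov a)⁻¹ * M.condCov s a

/-- The direct-method reward estimate `r̂(x, a) = φ(x)ᵀ μ̂_a`, computed from the sample. -/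
def rewardEstimate (x : 𝒳) (a : Fin K) : ℝ :=
  (M.φ x).ofLp ⬝ᵥ (M.postMean s a).ofLp

end Posterior

/-- Well-specified priors: the latent parameter `ψ`, the true action parameters
`θ = (θ_{*,a})_a` and the rewards are drawn from the model; conditionally on `ψ` the `θ_{*,a}` are
independent, the logged contexts and actions are independent of the parameters, and conditionally
on everything else the rewards are independent. -/
structure WellSpecified {n : ℕ} {Ω : Type*} [MeasurableSpace Ω] (P : Measure Ω)
    [IsProbabilityMeasure P] (ψ : Ω → EuclideanSpace ℝ (Fin d'))
    (θ : Ω → Fin K → EuclideanSpace ℝ (Fin d))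
    (X : Ω → Fin n → 𝒳) (A : Ω → Fin n → Fin K) (R : Ω → Fin n → ℝ) : Prop where
  measurable_ψ : Measurable ψ
  measurable_θ : Measurable θ
  measurable_X : Measurable X
  measurable_A : Measurable A
  measurable_R : Measurable R
  /-- `ψ ∼ N(μ, Σ)` -/
  law_latent : P.map ψ = multivariateGaussian M.μ M.latentCov
  /-- given `ψ`, the `θ_{*,a}` are independent with `θ_{*,a} ∼ N(W_a ψ, Σ_a)` -/
  law_action : condDistrib θ ψ P =ᵐ[P.map ψ] fun p =>
    Measure.pi fun a =>
      multivariateGaussian (WithLp.toLp 2 ((M.W a).mulVec p.ofLp)) (M.actionCov a)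
  /-- `(X_i, A_i)_i` is independent of `(ψ, θ_*)`; equivalently, it is independent of `ψ` and,
  given `ψ`, independent of `θ_*` -/
  indep_design : IndepFun (fun ω => (ψ ω, θ ω)) (fun ω => (X ω, A ω)) P
  /-- given `ψ, θ_*` and `(X_i, A_i)_i`, the `R_i` are independent with
  `R_i ∼ N(φ(X_i)ᵀ θ_{*,A_i}, σ²)` -/
  law_reward : condDistrib R (fun ω => (ψ ω, θ ω, X ω, A ω)) P
    =ᵐ[P.map fun ω => (ψ ω, θ ω, X ω, A ω)] fun q =>
      Measure.pi fun i => M.rewardLaw (q.2.2.1 i) (q.2.1 (q.2.2.2 i))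

end Model

/-- The observed sample `S = (X_i, A_i, R_i)_{i ∈ [n]}` as a random variable. -/
def sample {𝒳 Ω : Type*} {K n : ℕ} (X : Ω → Fin n → 𝒳) (A : Ω → Fin n → Fin K)
    (R : Ω → Fin n → ℝ) (ω : Ω) : Sample 𝒳 K n :=
  fun i => (X ω i, A ω i, R ω i)

/-- The Bayesian mean squared error `E[(r̂(x, a) - r(x, a; θ_*))²]` of an estimator `rhat` of
`r(x, a; θ_*)` that is a function of the sample; the expectation is over both the sample `S` and
the true parameter `θ`. -/
def bayesianMSE {𝒳 Ω : Type*} [MeasurableSpace 𝒳] [MeasurableSpace Ω] {K d d' n : ℕ}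
    (M : Model 𝒳 K d d') (P : Measure Ω) (S : Ω → Sample 𝒳 K n)
    (θ : Ω → Fin K → EuclideanSpace ℝ (Fin d)) (x : 𝒳) (a : Fin K)
    (rhat : Sample 𝒳 K n → ℝ) : ℝ :=
  ∫ ω, (rhat (S ω) - M.reward x a (θ ω)) ^ 2 ∂P

end StructuredBandit

end

noncomputable section

namespace StructuredBandit

open Matrix

/-! Given the design, the parameters and the rewards are jointly Gaussian. A functional `∑ c b ⬝ᵥ θ
b + ∑ v i * R i` has mean `latentCoef (c + featureCoef v) ⬝ᵥ μ` and variance `jointVar c v`.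
Conditioning is therefore linear regression, and neither densities nor Bayes' formula are needed.

For a direction `t`, the rewards enter `t ⬝ᵥ μ̂_a` linearly with design-only coefficients `regCoef`
(`dotProduct_postMean`). The residual `t ⬝ᵥ (θ_a - μ̂_a)` has mean zero, is uncorrelated with every
reward, and has variance `tᵀ Σ̂_a t`. This is the algebraic core, `jointVar_sub_regCoef`, which
rests on the normal equations solved by `postCross` and `latentPostCross`.

For Gaussians, uncorrelated means independent. In characteristic functions, weighted by indicators
of design events, this is `integral_exp_resid`. By uniqueness of characteristic functions,
`map_sample_resid` follows: the pair (sample, residual) has law `P_S ⊗ N(0, Σ̂_a)`, where `Σ̂_a`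
depends on the design only. Translating by `μ̂_a` gives the posterior, projecting on `φ(x)` gives
its marginal, and Fubini applied to the squared projected residual gives the mean squared error.
Finiteness comes from the bound of the posterior variance by the prior variance. -/

/-! ### Positive definiteness of the posterior matrices. -/

-- The matrix is that of the quadratic form `x ↦ min_y (yᵀ G y + (x - y)ᵀ P (x - y))`, with
-- minimiser `y = (P + G)⁻¹ P x`. Inserting this minimiser writes it as a sum of two congruences of
-- positive semidefinite matrices. With `P = Σ_a⁻¹` it is the information on `W_a ψ` carried by the
-- rewards of action `a`.
open scoped MatrixOrder in
lemma posSemidef_sub_mul_inv_mul {d : ℕ} {P G : Matrix (Fin d) (Fin d) ℝ} (hP : P.PosDef)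
    (hG : G.PosSemidef) : (P - P * (P + G)⁻¹ * P).PosSemidef := by
  have hPG : (P + G).PosDef := hP.add_posSemidef hG
  have hinv : (P + G)⁻¹ * (P + G) = 1 := Matrix.nonsing_inv_mul _ hPG.det_pos.ne'.isUnit
  have hinv' : (P + G) * (P + G)⁻¹ = 1 := Matrix.mul_nonsing_inv _ hPG.det_pos.ne'.isUnit
  have hT : ((P + G)⁻¹)ᴴ = (P + G)⁻¹ := hPG.inv.1
  set T := (P + G)⁻¹ with hTdef
  have key : P - P * T * P = (T * P)ᴴ * G * (T * P) + (1 - T * P)ᴴ * P * (1 - T * P) := by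
    have hPs : Pᴴ = P := hP.1
    rw [conjTranspose_sub, conjTranspose_mul, hT, hPs, conjTranspose_one]
    have e : P * T * G * T * P + P * T * P * T * P = P * T * P := by
      calc _ = P * T * ((P + G) * T) * P := by noncomm_ring
        _ = _ := by rw [hinv']; simp
    calc P - P * T * P
        = P - P * T * P - P * T * P + P * T * P := by abel
      _ = P - P * T * P - P * T * P + (P * T * G * T * P + P * T * P * T * P) := by rw [e]
      _ = _ := by noncomm_ring
  rw [key]
  exact (hG.conjTranspose_mul_mul_same _).add (hP.posSemidef.conjTranspose_mul_mul_same _)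

lemma mulVec_dotProduct_eq {k l : ℕ} (N : Matrix (Fin k) (Fin l) ℝ) (v : Fin l → ℝ)
    (w : Fin k → ℝ) :
    N *ᵥ v ⬝ᵥ w = v ⬝ᵥ Nᵀ *ᵥ w := by
  rw [dotProduct_comm, dotProduct_mulVec, dotProduct_comm, mulVec_transpose]

lemma sum_single_dotProduct {K d : ℕ} (a : Fin K) (t : Fin d → ℝ) (z : Fin K → Fin d → ℝ) :
    ∑ b, (Pi.single a t : Fin K → Fin d → ℝ) b ⬝ᵥ z b = t ⬝ᵥ z a := by
  rw [Finset.sum_eq_single a]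
  · simp
  · intro b _ hb; simp [Pi.single_eq_of_ne hb]
  · simp

namespace Model

variable {𝒳 : Type*} [MeasurableSpace 𝒳] {K d d' n : ℕ} (M : Model 𝒳 K d d')

lemma posSemidef_G (s : Sample 𝒳 K n) (a : Fin K) : (M.G s a).PosSemidef := by
  unfold G
  refine Matrix.PosSemidef.smul (Matrix.posSemidef_sum _ fun i _ => ?_) (by positivity)
  split_ifs
  · simpa using Matrix.posSemidef_vecMulVec_self_star (M.φ (s i).1).ofLp
  · exact Matrix.PosSemidef.zero

lemma posDef_condPrec (s : Sample 𝒳 K n) (a : Fin K) : ((M.actionCov a)⁻¹ + M.G s a).PosDef :=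
  (M.posDef_actionCov a).inv.add_posSemidef (M.posSemidef_G s a)

lemma posDef_condCov (s : Sample 𝒳 K n) (a : Fin K) : (M.condCov s a).PosDef :=
  (M.posDef_condPrec s a).inv

lemma posDef_latentPrec (s : Sample 𝒳 K n) :
    (M.latentCov⁻¹ + ∑ a, (M.W a).transpose *
      ((M.actionCov a)⁻¹ - (M.actionCov a)⁻¹ * M.condCov s a * (M.actionCov a)⁻¹) *
        M.W a).PosDef := by
  refine M.posDef_latentCov.inv.add_posSemidef (Matrix.posSemidef_sum _ fun a _ => ?_)
  have := (posSemidef_sub_mul_inv_mul (M.posDef_actionCov a).inv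
    (M.posSemidef_G s a)).conjTranspose_mul_mul_same (M.W a)
  rwa [conjTranspose_eq_transpose_of_trivial] at this

lemma posDef_latentPostCov (s : Sample 𝒳 K n) : (M.latentPostCov s).PosDef :=
  (M.posDef_latentPrec s).inv

lemma transpose_inv_actionCov (a : Fin K) : ((M.actionCov a)⁻¹)ᵀ = (M.actionCov a)⁻¹ :=
  (M.posDef_actionCov a).inv.1

lemma transpose_condCov (s : Sample 𝒳 K n) (a : Fin K) : (M.condCov s a)ᵀ = M.condCov s a :=
  (M.posDef_condCov s a).1

lemma transpose_latentPostCov (s : Sample 𝒳 K n) : (M.latentPostCov s)ᵀ = M.latentPostCov s :=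
  (M.posDef_latentPostCov s).1

lemma posDef_postCov (s : Sample 𝒳 K n) (a : Fin K) : (M.postCov s a).PosDef := by
  refine (M.posDef_condCov s a).add_posSemidef ?_
  have := (M.posDef_latentPostCov s).posSemidef.mul_mul_conjTranspose_same
    (M.condCov s a * (M.actionCov a)⁻¹ * M.W a)
  simpa [conjTranspose_eq_transpose_of_trivial, transpose_mul, transpose_inv_actionCov,
    transpose_condCov, Matrix.mul_assoc] using this

/-! ### Means and variances of linear functionals of the parameters and the rewards. -/

/-- The coefficient of `ψ` in the conditional mean of `∑ b, c b ⬝ᵥ θ b` given `ψ`. -/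
def latentCoef (c : Fin K → Fin d → ℝ) : Fin d' → ℝ := ∑ b, (M.W b)ᵀ *ᵥ c b

/-- The prior variance of `∑ b, c b ⬝ᵥ θ b`. -/
def priorVar (c : Fin K → Fin d → ℝ) : ℝ :=
  ∑ b, c b ⬝ᵥ M.actionCov b *ᵥ c b + M.latentCoef c ⬝ᵥ M.latentCov *ᵥ M.latentCoef c

lemma priorVar_nonneg (c : Fin K → Fin d → ℝ) : 0 ≤ M.priorVar c :=
  add_nonneg
    (Finset.sum_nonneg fun b _ => by
      simpa using (M.posDef_actionCov b).posSemidef.dotProduct_mulVec_nonneg (c b))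
    (by simpa using M.posDef_latentCov.posSemidef.dotProduct_mulVec_nonneg (M.latentCoef c))

/-- The coefficient of `θ b` in the conditional mean of `∑ i, v i * R i` given `θ`. -/
def featureCoef (s : Sample 𝒳 K n) (v : Fin n → ℝ) (b : Fin K) : Fin d → ℝ :=
  ∑ i, if (s i).2.1 = b then v i • (M.φ (s i).1).ofLp else 0

lemma sum_featureCoef_dotProduct (s : Sample 𝒳 K n) (v : Fin n → ℝ) (z : Fin K → Fin d → ℝ) :
    ∑ b, M.featureCoef s v b ⬝ᵥ z b =
      ∑ i, v i * ((M.φ (s i).1).ofLp ⬝ᵥ z (s i).2.1) := by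
  simp only [featureCoef, sum_dotProduct]
  rw [Finset.sum_comm]
  refine Finset.sum_congr rfl fun i _ => ?_
  rw [Finset.sum_eq_single (s i).2.1]
  · simp
  · intro b _ hb; simp [Ne.symm hb]
  · simp

lemma featureCoef_sub (s : Sample 𝒳 K n) (u v : Fin n → ℝ) :
    M.featureCoef s (u - v) = M.featureCoef s u - M.featureCoef s v := by
  funext b
  rw [Pi.sub_apply, featureCoef, featureCoef, featureCoef, ← Finset.sum_sub_distrib]
  refine Finset.sum_congr rfl fun i _ => ?_
  split_ifs <;> simp [sub_smul]

/-- The variance of `∑ b, c b ⬝ᵥ θ b + ∑ i, v i * R i` given the design. -/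
def jointVar (s : Sample 𝒳 K n) (c : Fin K → Fin d → ℝ) (v : Fin n → ℝ) : ℝ :=
  M.σ ^ 2 * ∑ i, v i ^ 2 + M.priorVar (c + M.featureCoef s v)

lemma jointVar_nonneg (s : Sample 𝒳 K n) (c : Fin K → Fin d → ℝ) (v : Fin n → ℝ) :
    0 ≤ M.jointVar s c v :=
  add_nonneg (by positivity) (M.priorVar_nonneg _)

/-! ### Regression of `t ⬝ᵥ θ_a` on the rewards. -/

section Regression

variable (s : Sample 𝒳 K n) (a : Fin K) (t : Fin d → ℝ)

/-- `Σ̄ W_aᵀ Σ_a⁻¹ Σ̃_a t`, the posterior covariance of `ψ` and `t ⬝ᵥ θ_a`. -/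
def latentPostCross : Fin d' → ℝ :=
  M.latentPostCov s *ᵥ (M.W a)ᵀ *ᵥ (M.actionCov a)⁻¹ *ᵥ M.condCov s a *ᵥ t

/-- The posterior covariance of `θ_b` and `t ⬝ᵥ θ_a`. -/
def postCross (b : Fin K) : Fin d → ℝ :=
  M.condCov s b *ᵥ ((Pi.single a t : Fin K → Fin d → ℝ) b +
    (M.actionCov b)⁻¹ *ᵥ M.W b *ᵥ M.latentPostCross s a t)

/-- The coefficients of the rewards in the posterior mean of `t ⬝ᵥ θ_a`. -/
def regCoef (i : Fin n) : ℝ :=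
  (M.σ ^ 2)⁻¹ * ((M.φ (s i).1).ofLp ⬝ᵥ M.postCross s a t (s i).2.1)

/-- The coefficients of `θ` in the residual of the regression of `t ⬝ᵥ θ_a` on the rewards. -/
def residCoef : Fin K → Fin d → ℝ :=
  (Pi.single a t : Fin K → Fin d → ℝ) - M.featureCoef s (M.regCoef s a t)

lemma featureCoef_regCoef (b : Fin K) :
    M.featureCoef s (M.regCoef s a t) b = M.G s b *ᵥ M.postCross s a t b := by
  simp only [featureCoef, regCoef, G, smul_mulVec, sum_mulVec, Finset.smul_sum]
  refine Finset.sum_congr rfl fun i _ => ?_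
  split_ifs with h
  · rw [vecMulVec_mulVec, h, mul_smul]; simp
  · simp

/-- Normal equation at action level: `postCross` solves a system with matrix `Σ_b⁻¹ + G_b`, and its
`G_b` part is exactly what `residCoef` subtracts, by `featureCoef_regCoef`. -/
lemma inv_mulVec_postCross (b : Fin K) :
    (M.actionCov b)⁻¹ *ᵥ M.postCross s a t b =
      M.residCoef s a t b + (M.actionCov b)⁻¹ *ᵥ M.W b *ᵥ M.latentPostCross s a t := by
  have h : ((M.actionCov b)⁻¹ + M.G s b) *ᵥ M.postCross s a t b =
      (Pi.single a t : Fin K → Fin d → ℝ) b +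
        (M.actionCov b)⁻¹ *ᵥ M.W b *ᵥ M.latentPostCross s a t := by
    rw [postCross, mulVec_mulVec, condCov,
      Matrix.mul_nonsing_inv _ (M.posDef_condPrec s b).det_pos.ne'.isUnit, one_mulVec]
  rw [add_mulVec] at h
  rw [residCoef, Pi.sub_apply, featureCoef_regCoef, sub_add_eq_add_sub, ← h]
  abel

/-- Together with `latentPostCross_eq`, this identifies `postCross` as the prior covariance of `θ_b`
with the functional of coefficients `residCoef`, so that it is the cross term in `priorVar_add`. -/
lemma postCross_eq (b : Fin K) :
    M.postCross s a t b =
      M.actionCov b *ᵥ M.residCoef s a t b + M.W b *ᵥ M.latentPostCross s a t := by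
  have h := congrArg (M.actionCov b *ᵥ ·) (M.inv_mulVec_postCross s a t b)
  simpa [mulVec_add, mulVec_mulVec, ← Matrix.mul_assoc,
    Matrix.mul_nonsing_inv _ (M.posDef_actionCov b).det_pos.ne'.isUnit] using h

/-- Normal equation at latent level: `latentPostCross` solves a system whose matrix is the posterior
precision of `ψ`. Expressing `residCoef` through `postCross` makes the sum over actions cancel and
leaves only the `Σ⁻¹` term. -/
lemma latentCoef_residCoef :
    M.latentCoef (M.residCoef s a t) = M.latentCov⁻¹ *ᵥ M.latentPostCross s a t := by
  have h : (M.latentCov⁻¹ + ∑ a, (M.W a).transpose *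
      ((M.actionCov a)⁻¹ - (M.actionCov a)⁻¹ * M.condCov s a * (M.actionCov a)⁻¹) *
        M.W a) *ᵥ M.latentPostCross s a t =
      (M.W a)ᵀ *ᵥ (M.actionCov a)⁻¹ *ᵥ M.condCov s a *ᵥ t := by
    rw [latentPostCross, mulVec_mulVec, latentPostCov,
      Matrix.mul_nonsing_inv _ (M.posDef_latentPrec s).det_pos.ne'.isUnit, one_mulVec]
  have hc : ∀ b, M.residCoef s a t b = (M.actionCov b)⁻¹ *ᵥ M.postCross s a t b -
      (M.actionCov b)⁻¹ *ᵥ M.W b *ᵥ M.latentPostCross s a t := fun b => by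
    rw [inv_mulVec_postCross]; abel
  have hs : (M.W a)ᵀ *ᵥ (M.actionCov a)⁻¹ *ᵥ M.condCov s a *ᵥ t =
      ∑ b, (M.W b)ᵀ *ᵥ (M.actionCov b)⁻¹ *ᵥ M.condCov s b *ᵥ
        (Pi.single a t : Fin K → Fin d → ℝ) b := by
    rw [Finset.sum_eq_single a]
    · simp
    · intro b _ hb; simp [Pi.single_eq_of_ne hb]
    · simp
  rw [add_mulVec, sum_mulVec, ← eq_sub_iff_add_eq, hs, ← Finset.sum_sub_distrib] at h
  rw [h, latentCoef]
  refine Finset.sum_congr rfl fun b _ => ?_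
  rw [hc, postCross]
  simp only [mulVec_add, mulVec_sub, sub_mulVec, Matrix.mul_sub, Matrix.sub_mul, ← mulVec_mulVec]
  abel

lemma latentPostCross_eq :
    M.latentPostCross s a t = M.latentCov *ᵥ M.latentCoef (M.residCoef s a t) := by
  rw [latentCoef_residCoef, mulVec_mulVec,
    Matrix.mul_nonsing_inv _ M.posDef_latentCov.det_pos.ne'.isUnit, one_mulVec]

lemma dotProduct_postCov_mulVec : t ⬝ᵥ M.postCov s a *ᵥ t = t ⬝ᵥ M.postCross s a t a := by
  simp only [postCov, postCross, latentPostCross, Pi.single_eq_same, add_mulVec, mulVec_add,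
    ← mulVec_mulVec]

lemma sum_postCross_dotProduct_B :
    ∑ b, M.postCross s a t b ⬝ᵥ M.B s b = ∑ i, M.regCoef s a t i * (s i).2.2 := by
  have : ∀ b, M.B s b = (M.σ ^ 2)⁻¹ • M.featureCoef s (fun i => (s i).2.2) b := fun b => rfl
  simp only [this, dotProduct_smul, ← Finset.smul_sum]
  simp only [dotProduct_comm (M.postCross s a t _)]
  rw [sum_featureCoef_dotProduct, Finset.smul_sum]
  refine Finset.sum_congr rfl fun i _ => ?_
  rw [regCoef, smul_eq_mul]; ring

/-- The posterior mean is affine in the rewards. Its constant term is the prior mean of the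
functional `residCoef`, which is why the residual is centred. -/
lemma dotProduct_postMean :
    t ⬝ᵥ (M.postMean s a).ofLp = M.latentCoef (M.residCoef s a t) ⬝ᵥ M.μ.ofLp +
      ∑ i, M.regCoef s a t i * (s i).2.2 := by
  have hL : (M.latentCov⁻¹)ᵀ = M.latentCov⁻¹ := M.posDef_latentCov.inv.1
  have hmean : t ⬝ᵥ (M.postMean s a).ofLp = t ⬝ᵥ M.condCov s a *ᵥ M.B s a +
      M.latentPostCross s a t ⬝ᵥ (M.latentCov⁻¹ *ᵥ M.μ.ofLp +
        ∑ b, ((M.W b)ᵀ * (M.actionCov b)⁻¹ * M.condCov s b) *ᵥ M.B s b) := by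
    simp only [postMean, latentPostMean, latentPostCross, mulVec_add (M.condCov s a),
      dotProduct_add t, mulVec_dotProduct_eq, transpose_condCov, transpose_latentPostCov,
      transpose_inv_actionCov, transpose_transpose, ← mulVec_mulVec]
  have hB : ∑ b, M.postCross s a t b ⬝ᵥ M.B s b = t ⬝ᵥ M.condCov s a *ᵥ M.B s a +
      M.latentPostCross s a t ⬝ᵥ
        ∑ b, ((M.W b)ᵀ * (M.actionCov b)⁻¹ * M.condCov s b) *ᵥ M.B s b := by
    have hs : t ⬝ᵥ M.condCov s a *ᵥ M.B s a =
        ∑ b, (Pi.single a t : Fin K → Fin d → ℝ) b ⬝ᵥ M.condCov s b *ᵥ M.B s b :=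
      (sum_single_dotProduct a t fun b => M.condCov s b *ᵥ M.B s b).symm
    rw [hs, dotProduct_sum, ← Finset.sum_add_distrib]
    refine Finset.sum_congr rfl fun b _ => ?_
    simp only [postCross, mulVec_dotProduct_eq, add_dotProduct, transpose_condCov,
      transpose_inv_actionCov, ← mulVec_mulVec]
  rw [hmean, dotProduct_add, add_left_comm, ← hB, sum_postCross_dotProduct_B,
    latentCoef_residCoef, mulVec_dotProduct_eq, hL]

lemma latentCoef_add (c e : Fin K → Fin d → ℝ) :
    M.latentCoef (c + e) = M.latentCoef c + M.latentCoef e := by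
  simp [latentCoef, mulVec_add, Finset.sum_add_distrib]

lemma latentCoef_dotProduct (c : Fin K → Fin d → ℝ) (z : Fin d' → ℝ) :
    M.latentCoef c ⬝ᵥ z = ∑ b, c b ⬝ᵥ M.W b *ᵥ z := by
  simp [latentCoef, sum_dotProduct, mulVec_dotProduct_eq]

lemma priorVar_add (c e : Fin K → Fin d → ℝ) :
    M.priorVar (c + e) = M.priorVar c + M.priorVar e +
      2 * ∑ b, e b ⬝ᵥ (M.actionCov b *ᵥ c b + M.W b *ᵥ M.latentCov *ᵥ M.latentCoef c) := by
  have hs : ∀ b, c b ⬝ᵥ M.actionCov b *ᵥ e b = e b ⬝ᵥ M.actionCov b *ᵥ c b := fun b => by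
    have h : (M.actionCov b)ᵀ = M.actionCov b := (M.posDef_actionCov b).1
    rw [dotProduct_comm, mulVec_dotProduct_eq, h]
  have hl : M.latentCoef c ⬝ᵥ M.latentCov *ᵥ M.latentCoef e =
      M.latentCoef e ⬝ᵥ M.latentCov *ᵥ M.latentCoef c := by
    have h : M.latentCovᵀ = M.latentCov := M.posDef_latentCov.1
    rw [dotProduct_comm, mulVec_dotProduct_eq, h]
  simp only [priorVar, latentCoef_add, Pi.add_apply, mulVec_add, dotProduct_add, add_dotProduct,
    Finset.sum_add_distrib, hs, hl, ← latentCoef_dotProduct]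
  ring

lemma priorVar_residCoef :
    M.priorVar (M.residCoef s a t) = ∑ b, M.residCoef s a t b ⬝ᵥ M.postCross s a t b := by
  simp only [postCross_eq, dotProduct_add, Finset.sum_add_distrib, ← latentCoef_dotProduct]
  rw [priorVar, ← latentPostCross_eq]

lemma residCoef_add_featureCoef (u : Fin n → ℝ) :
    (Pi.single a t : Fin K → Fin d → ℝ) + M.featureCoef s (u - M.regCoef s a t) =
      M.residCoef s a t + M.featureCoef s u := by
  rw [featureCoef_sub, residCoef]; abel

/-- The residual of the regression of `t ⬝ᵥ θ_a` on the rewards is uncorrelated with them and has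
variance `tᵀ Σ̂_a t`. -/
lemma jointVar_sub_regCoef (u : Fin n → ℝ) :
    M.jointVar s (Pi.single a t) (u - M.regCoef s a t) =
      t ⬝ᵥ M.postCov s a *ᵥ t + M.jointVar s 0 u := by
  have hσ : M.σ ^ 2 ≠ 0 := (pow_pos M.σ_pos 2).ne'
  -- The factor `σ⁻²` in `regCoef` balances the noise variance. Hence the noise cross term cancels
  -- the prior cross term for every `u`; for `v = regCoef` the same identity evaluates the residual
  -- variance.
  have hreg : ∀ v : Fin n → ℝ, M.σ ^ 2 * ∑ i, v i * M.regCoef s a t i =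
      ∑ b, M.featureCoef s v b ⬝ᵥ M.postCross s a t b := fun v => by
    rw [sum_featureCoef_dotProduct, Finset.mul_sum]
    refine Finset.sum_congr rfl fun i _ => ?_
    rw [regCoef, mul_left_comm, mul_inv_cancel_left₀ hσ]
  have hsq : ∑ i, (u - M.regCoef s a t) i ^ 2 = ∑ i, u i ^ 2 -
      2 * ∑ i, u i * M.regCoef s a t i +
        ∑ i, M.regCoef s a t i * M.regCoef s a t i := by
    rw [Finset.mul_sum, ← Finset.sum_sub_distrib, ← Finset.sum_add_distrib]
    exact Finset.sum_congr rfl fun i _ => by rw [Pi.sub_apply]; ring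
  have hr : ∑ b, M.residCoef s a t b ⬝ᵥ M.postCross s a t b = t ⬝ᵥ M.postCross s a t a -
      ∑ b, M.featureCoef s (M.regCoef s a t) b ⬝ᵥ M.postCross s a t b := by
    have hs : t ⬝ᵥ M.postCross s a t a =
        ∑ b, (Pi.single a t : Fin K → Fin d → ℝ) b ⬝ᵥ M.postCross s a t b :=
      (sum_single_dotProduct a t (M.postCross s a t)).symm
    simp only [residCoef, Pi.sub_apply, sub_dotProduct, Finset.sum_sub_distrib, hs]
  rw [jointVar, jointVar, residCoef_add_featureCoef, priorVar_add, priorVar_residCoef, hsq, hr,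
    dotProduct_postCov_mulVec, zero_add]
  simp only [← latentPostCross_eq, ← postCross_eq]
  rw [← hreg, ← hreg]
  ring

/-- Taking `u = regCoef` leaves `t ⬝ᵥ θ_a` alone, whose variance splits into a posterior part and a
nonnegative explained part. The bound is uniform in the sample, hence gives integrability. -/
lemma dotProduct_postCov_mulVec_le :
    t ⬝ᵥ M.postCov s a *ᵥ t ≤ M.priorVar (Pi.single a t) := by
  have h := M.jointVar_sub_regCoef s a t (M.regCoef s a t)
  have h0 := M.jointVar_nonneg s 0 (M.regCoef s a t)
  have hz : M.jointVar s (Pi.single a t) 0 = M.priorVar (Pi.single a t) := by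
    have : M.featureCoef s 0 = 0 := by simpa using M.featureCoef_sub s 0 0
    simp [jointVar, this]
  rw [sub_self, hz] at h
  linarith

end Regression
end Model

/-! ### Gaussian kernels, and tools for laws on product spaces. -/

-- The square root is continuous on the positive semidefinite cone, where `C` takes its values.
open scoped MatrixOrder Matrix.Norms.L2Operator in
lemma measurable_matrix_sqrt_apply {α : Type*} [MeasurableSpace α] {d : ℕ}
    {C : α → Matrix (Fin d) (Fin d) ℝ} (hC : ∀ i j, Measurable fun s => C s i j)
    (hpos : ∀ s, (C s).PosSemidef) (i j : Fin d) :
    Measurable fun s => CFC.sqrt (C s) i j := by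
  let _ : MeasurableSpace (Matrix (Fin d) (Fin d) ℝ) := MeasurableSpace.pi
  have : BorelSpace (Matrix (Fin d) (Fin d) ℝ) :=
    inferInstanceAs (BorelSpace (Fin d → Fin d → ℝ))
  have hcont := (CFC.continuousOn_sqrt (A := Matrix (Fin d) (Fin d) ℝ)).domRestrict
  have hm : Measurable C := measurable_pi_lambda _ fun i => measurable_pi_lambda _ fun j => hC i j
  have h : Measurable fun s => (⟨C s, (hpos s).nonneg⟩ : {a : Matrix (Fin d) (Fin d) ℝ | 0 ≤ a}) :=
    hm.subtype_mk
  have h2 := hcont.measurable.comp h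
  exact (measurable_pi_apply j).comp ((measurable_pi_apply i).comp h2)

-- `N(m, C)` is the image of the standard Gaussian under `z ↦ m + √C z`. This map is jointly
-- measurable in the parameter and `z`, so the mass of a fixed set is the measure of a measurable
-- section.
open scoped MatrixOrder in
lemma measurable_multivariateGaussian {α : Type*} [MeasurableSpace α] {d : ℕ}
    {m : α → EuclideanSpace ℝ (Fin d)} {C : α → Matrix (Fin d) (Fin d) ℝ} (hm : Measurable m)
    (hC : ∀ i j, Measurable fun s => C s i j) (hpos : ∀ s, (C s).PosSemidef) :
    Measurable fun s => multivariateGaussian (m s) (C s) := by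
  have hf : Measurable fun p : α × EuclideanSpace ℝ (Fin d) =>
      m p.1 + Matrix.toEuclideanCLM (𝕜 := ℝ) (CFC.sqrt (C p.1)) p.2 := by
    refine (hm.comp measurable_fst).add ?_
    refine (WithLp.measurable_toLp 2 (Fin d → ℝ)).comp (g := WithLp.toLp 2)
      (f := fun p : α × EuclideanSpace ℝ (Fin d) => CFC.sqrt (C p.1) *ᵥ p.2.ofLp) ?_
    refine measurable_pi_lambda _ fun i => ?_
    simp only [mulVec, dotProduct]
    refine Finset.measurable_sum _ fun j _ => ?_
    exact ((measurable_matrix_sqrt_apply hC hpos i j).comp measurable_fst).mul (by fun_prop)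
  refine Measure.measurable_of_measurable_coe _ fun A hA => ?_
  have : ∀ s, multivariateGaussian (m s) (C s) A =
      stdGaussian (EuclideanSpace ℝ (Fin d)) (Prod.mk s ⁻¹'
        ((fun p : α × EuclideanSpace ℝ (Fin d) =>
          m p.1 + Matrix.toEuclideanCLM (𝕜 := ℝ) (CFC.sqrt (C p.1)) p.2) ⁻¹' A)) := fun s => by
    rw [multivariateGaussian, Measure.map_apply (by fun_prop) hA]; rfl
  simp_rw [this]
  exact measurable_measure_prodMk_left (hf hA)

/-- The Markov kernel `s ↦ N(m s, C s)`. -/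
def gaussianKernel {α : Type*} [MeasurableSpace α] {d : ℕ}
    (m : α → EuclideanSpace ℝ (Fin d)) (C : α → Matrix (Fin d) (Fin d) ℝ) (hm : Measurable m)
    (hC : ∀ i j, Measurable fun s => C s i j) (hpos : ∀ s, (C s).PosSemidef) :
    Kernel α (EuclideanSpace ℝ (Fin d)) :=
  ⟨fun s => multivariateGaussian (m s) (C s), measurable_multivariateGaussian hm hC hpos⟩

instance {α : Type*} [MeasurableSpace α] {d : ℕ}
    (m : α → EuclideanSpace ℝ (Fin d)) (C : α → Matrix (Fin d) (Fin d) ℝ) (hm : Measurable m)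
    (hC : ∀ i j, Measurable fun s => C s i j) (hpos : ∀ s, (C s).PosSemidef) :
    IsMarkovKernel (gaussianKernel m C hm hC hpos) :=
  ⟨fun s => inferInstanceAs (IsProbabilityMeasure (multivariateGaussian (m s) (C s)))⟩

lemma map_dotProduct_multivariateGaussian {d : ℕ} (m : EuclideanSpace ℝ (Fin d))
    {C : Matrix (Fin d) (Fin d) ℝ} (hC : C.PosSemidef) (v : EuclideanSpace ℝ (Fin d)) :
    (multivariateGaussian m C).map (fun z => v.ofLp ⬝ᵥ z.ofLp) =
      gaussianReal (v.ofLp ⬝ᵥ m.ofLp) (v.ofLp ⬝ᵥ C *ᵥ v.ofLp).toNNReal := by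
  have hinner : (fun z : EuclideanSpace ℝ (Fin d) => v.ofLp ⬝ᵥ z.ofLp) = innerSL ℝ v := by
    ext z; simp [EuclideanSpace.inner_eq_star_dotProduct, dotProduct_comm]
  rw [hinner, IsGaussian.map_eq_gaussianReal]
  congr 1
  · rw [ContinuousLinearMap.integral_comp_id_comm IsGaussian.integrable_id,
      integral_id_multivariateGaussian]
    simp [EuclideanSpace.inner_eq_star_dotProduct, dotProduct_comm]
  · rw [← covarianceBilin_multivariateGaussian (μ := m) hC,
      covarianceBilin_self IsGaussian.memLp_two_id]
    rfl

lemma charFun_multivariateGaussian_dotProduct {d : ℕ} (m : EuclideanSpace ℝ (Fin d))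
    {C : Matrix (Fin d) (Fin d) ℝ} (hC : C.PosSemidef) (v : Fin d → ℝ) :
    ∫ z, Complex.exp ((v ⬝ᵥ z.ofLp : ℝ) * Complex.I) ∂(multivariateGaussian m C) =
      Complex.exp ((v ⬝ᵥ m.ofLp : ℝ) * Complex.I - (v ⬝ᵥ C *ᵥ v : ℝ) / 2) := by
  have h := charFun_multivariateGaussian (μ := m) hC (WithLp.toLp 2 v)
  simpa [charFun_apply, EuclideanSpace.inner_eq_star_dotProduct, dotProduct_comm] using h

/-- Finite measures on `D × E` that agree on the products of measurable sets with characters are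
equal. -/
lemma measure_prod_ext_of_charFunDual {D E : Type*} [MeasurableSpace D] [NormedAddCommGroup E]
    [NormedSpace ℝ E] [MeasurableSpace E] [BorelSpace E] [SecondCountableTopology E]
    [CompleteSpace E] {ρ₁ ρ₂ : Measure (D × E)} [IsFiniteMeasure ρ₁] [IsFiniteMeasure ρ₂]
    (h : ∀ B : Set D, MeasurableSet B → ∀ L : StrongDual ℝ E,
      ∫ p, B.indicator 1 p.1 * Complex.exp (L p.2 * Complex.I) ∂ρ₁ =
        ∫ p, B.indicator 1 p.1 * Complex.exp (L p.2 * Complex.I) ∂ρ₂) : ρ₁ = ρ₂ := by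
  refine Measure.ext_prod fun {B V} hB hV => ?_
  -- The hypothesis says that the restrictions to the slab over `B`, projected to `E`, have equal
  -- characteristic functions. No topology on `D` is involved.
  have key : ∀ ρ : Measure (D × E), ∀ L : StrongDual ℝ E,
      charFunDual ((ρ.restrict (B ×ˢ Set.univ)).map Prod.snd) L =
        ∫ p, B.indicator 1 p.1 * Complex.exp (L p.2 * Complex.I) ∂ρ := fun ρ L => by
    rw [charFunDual_apply, integral_map (by fun_prop)
      (Measurable.aestronglyMeasurable (by fun_prop)),
      ← integral_indicator (hB.prod MeasurableSet.univ)]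
    refine integral_congr_ae (ae_of_all _ fun p => ?_)
    by_cases hp : p.1 ∈ B <;> simp [hp, Set.indicator]
  have hmap : (ρ₁.restrict (B ×ˢ Set.univ)).map Prod.snd =
      (ρ₂.restrict (B ×ˢ Set.univ)).map Prod.snd := by
    refine Measure.ext_of_charFunDual (funext fun L => ?_)
    rw [key, key, h B hB L]
  have happ : ∀ ρ : Measure (D × E), (ρ.restrict (B ×ˢ Set.univ)).map Prod.snd V = ρ (B ×ˢ V) :=
    fun ρ => by
      rw [Measure.map_apply measurable_snd hV, Measure.restrict_apply (measurable_snd hV)]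
      congr 1
      ext p; simp [and_comm]
  rw [← happ, ← happ, hmap]

/-- Integrals of bounded functions through a version of the conditional distribution. -/
lemma integral_eq_integral_condDistrib {Ω β γ : Type*} [MeasurableSpace Ω] [MeasurableSpace β]
    [MeasurableSpace γ] [StandardBorelSpace γ] [Nonempty γ] {P : Measure Ω} [IsFiniteMeasure P]
    {X : Ω → β} {Y : Ω → γ} (hX : Measurable X) (hY : Measurable Y) {κ : β → Measure γ}
    (hκ : condDistrib Y X P =ᵐ[P.map X] κ) {F : β × γ → ℂ} (hF : Measurable F)
    {c : ℝ} (hb : ∀ p, ‖F p‖ ≤ c) :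
    ∫ ω, F (X ω, Y ω) ∂P = ∫ ω, ∫ y, F (X ω, y) ∂(κ (X ω)) ∂P := by
  have hint : Integrable F (P.map X ⊗ₘ condDistrib Y X P) :=
    Integrable.of_bound hF.aestronglyMeasurable c (ae_of_all _ hb)
  have h1 : ∫ ω, F (X ω, Y ω) ∂P = ∫ p, F p ∂(P.map X ⊗ₘ condDistrib Y X P) := by
    rw [compProd_map_condDistrib hY.aemeasurable,
      integral_map (by fun_prop) hF.aestronglyMeasurable]
  rw [h1, Measure.integral_compProd hint, integral_map hX.aemeasurable]
  · exact integral_congr_ae ((ae_of_ae_map hX.aemeasurable hκ).mono fun ω hω => by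
      simp only [hω])
  · exact (hF.stronglyMeasurable.integral_kernel_prod_right').aestronglyMeasurable


/-! ### Measurability of the posterior quantities as functions of the sample. -/

section EntrywiseMeasurable

variable {α : Type*} [MeasurableSpace α]

lemma measurable_matrix_mul_apply {k l m : ℕ} {A : α → Matrix (Fin k) (Fin l) ℝ}
    {B : α → Matrix (Fin l) (Fin m) ℝ} (hA : ∀ i j, Measurable fun s => A s i j)
    (hB : ∀ i j, Measurable fun s => B s i j) (i : Fin k) (j : Fin m) :
    Measurable fun s => (A s * B s) i j := by
  simp only [Matrix.mul_apply]
  exact Finset.measurable_sum _ fun x _ => (hA i x).mul (hB x j)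

lemma measurable_matrix_det {k : ℕ} {A : α → Matrix (Fin k) (Fin k) ℝ}
    (hA : ∀ i j, Measurable fun s => A s i j) : Measurable fun s => (A s).det := by
  simp only [Matrix.det_apply']
  exact Finset.measurable_sum _ fun p _ =>
    (Finset.measurable_prod _ fun i _ => hA _ _).const_mul _

/-- By Cramer's rule every entry is a quotient of determinants, with the value zero where the
determinant vanishes. -/
lemma measurable_matrix_inv_apply {k : ℕ} {A : α → Matrix (Fin k) (Fin k) ℝ}
    (hA : ∀ i j, Measurable fun s => A s i j) (i j : Fin k) :
    Measurable fun s => (A s)⁻¹ i j := by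
  simp only [Matrix.inv_def, Ring.inverse_eq_inv', Matrix.smul_apply, smul_eq_mul,
    Matrix.adjugate_apply]
  refine (measurable_matrix_det hA).inv.mul (measurable_matrix_det fun x y => ?_)
  by_cases h : x = j
  · subst h; simp
  · simpa [Matrix.updateRow_ne h] using hA x y

lemma measurable_matrix_mulVec {k l : ℕ} {A : α → Matrix (Fin k) (Fin l) ℝ}
    {v : α → Fin l → ℝ} (hA : ∀ i j, Measurable fun s => A s i j) (hv : Measurable v) :
    Measurable fun s => A s *ᵥ v s := by
  refine measurable_pi_lambda _ fun i => ?_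
  simp only [mulVec, dotProduct]
  exact Finset.measurable_sum _ fun j _ => (hA i j).mul ((measurable_pi_apply j).comp hv)

lemma measurable_dotProduct {k : ℕ} {v w : α → Fin k → ℝ} (hv : Measurable v)
    (hw : Measurable w) : Measurable fun s => v s ⬝ᵥ w s := by
  simp only [dotProduct]
  exact Finset.measurable_sum _ fun j _ =>
    ((measurable_pi_apply j).comp hv).mul ((measurable_pi_apply j).comp hw)

end EntrywiseMeasurable

namespace Model

variable {𝒳 : Type*} [MeasurableSpace 𝒳] {K d d' n : ℕ} (M : Model 𝒳 K d d')

lemma measurable_feature (i : Fin n) :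
    Measurable fun s : Sample 𝒳 K n => (M.φ (s i).1).ofLp :=
  (WithLp.measurable_ofLp 2 _).comp
    (M.measurable_φ.comp (measurable_fst.comp (measurable_pi_apply i)))

lemma measurableSet_action_eq (i : Fin n) (a : Fin K) :
    MeasurableSet {s : Sample 𝒳 K n | (s i).2.1 = a} :=
  (measurable_fst.comp (measurable_snd.comp (measurable_pi_apply i)))
    (measurableSet_singleton a)

lemma measurable_G_apply (a : Fin K) (j k : Fin d) :
    Measurable fun s : Sample 𝒳 K n => M.G s a j k := by
  simp only [G, Matrix.smul_apply, Matrix.sum_apply]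
  refine Measurable.const_smul (M := ℝ) (X := ℝ) ?_ _
  refine Finset.measurable_sum _ fun i _ => ?_
  have h : ∀ s : Sample 𝒳 K n, (if (s i).2.1 = a then
      Matrix.vecMulVec (M.φ (s i).1).ofLp (M.φ (s i).1).ofLp else 0) j k =
      if (s i).2.1 = a then (M.φ (s i).1).ofLp j * (M.φ (s i).1).ofLp k else 0 := fun s => by
    split_ifs <;> rfl
  simp only [h]
  exact Measurable.ite (measurableSet_action_eq i a)
    (((measurable_pi_apply j).comp (M.measurable_feature i)).mul
      ((measurable_pi_apply k).comp (M.measurable_feature i))) measurable_const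

lemma measurable_B (a : Fin K) : Measurable fun s : Sample 𝒳 K n => M.B s a := by
  unfold B
  refine Measurable.const_smul (M := ℝ) (X := Fin d → ℝ) ?_ _
  refine Finset.measurable_sum _ fun i _ => ?_
  exact Measurable.ite (measurableSet_action_eq i a)
    ((measurable_snd.comp (measurable_snd.comp (measurable_pi_apply i))).smul
      (M.measurable_feature i)) measurable_const

lemma measurable_condCov_apply (a : Fin K) (j k : Fin d) :
    Measurable fun s : Sample 𝒳 K n => M.condCov s a j k :=
  measurable_matrix_inv_apply (fun x y => (M.measurable_G_apply a x y).const_add _) j k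

lemma measurable_latentPostCov_apply (j k : Fin d') :
    Measurable fun s : Sample 𝒳 K n => M.latentPostCov s j k := by
  have hc : ∀ {p q : ℕ} (N : Matrix (Fin p) (Fin q) ℝ) (i j), Measurable
    fun _ : Sample 𝒳 K n => N i j := fun _ _ _ => measurable_const
  unfold latentPostCov
  refine measurable_matrix_inv_apply (fun x y => ?_) j k
  simp only [Matrix.add_apply, Matrix.sum_apply]
  refine (Finset.measurable_sum _ fun a _ => ?_).const_add _
  refine measurable_matrix_mul_apply (measurable_matrix_mul_apply (hc _) fun x y => ?_) (hc _) x y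
  simp only [Matrix.sub_apply]
  refine Measurable.const_sub ?_ _
  exact measurable_matrix_mul_apply (measurable_matrix_mul_apply (hc _)
    (M.measurable_condCov_apply a)) (hc _) x y

lemma measurable_latentPostMean : Measurable fun s : Sample 𝒳 K n => M.latentPostMean s := by
  refine measurable_matrix_mulVec M.measurable_latentPostCov_apply ?_
  refine (Finset.measurable_sum _ fun a _ => ?_).const_add _
  exact measurable_matrix_mulVec (measurable_matrix_mul_apply (fun _ _ => measurable_const)
    (M.measurable_condCov_apply a)) (M.measurable_B a)

lemma measurable_postMean (a : Fin K) : Measurable fun s : Sample 𝒳 K n => M.postMean s a := by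
  refine (WithLp.measurable_toLp 2 _).comp
    (measurable_matrix_mulVec (M.measurable_condCov_apply a) ((M.measurable_B a).add ?_))
  exact measurable_matrix_mulVec (fun _ _ => measurable_const) M.measurable_latentPostMean

lemma measurable_postCov_apply (a : Fin K) (j k : Fin d) :
    Measurable fun s : Sample 𝒳 K n => M.postCov s a j k := by
  refine (M.measurable_condCov_apply a j k).add ?_
  have hc : ∀ {p q : ℕ} (N : Matrix (Fin p) (Fin q) ℝ) (i j), Measurable
    fun _ : Sample 𝒳 K n => N i j := fun _ _ _ => measurable_const
  exact measurable_matrix_mul_apply (measurable_matrix_mul_apply (measurable_matrix_mul_apply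
    (measurable_matrix_mul_apply (measurable_matrix_mul_apply (measurable_matrix_mul_apply
      (M.measurable_condCov_apply a) (hc _)) (hc _)) M.measurable_latentPostCov_apply) (hc _))
      (hc _)) (M.measurable_condCov_apply a) j k

lemma measurable_featureCoef {v : Sample 𝒳 K n → Fin n → ℝ} (hv : Measurable v) (b : Fin K) :
    Measurable fun s : Sample 𝒳 K n => M.featureCoef s (v s) b := by
  unfold featureCoef
  refine Finset.measurable_sum _ fun i _ => ?_
  exact Measurable.ite (measurableSet_action_eq i b)
    (((measurable_pi_apply i).comp hv).smul (M.measurable_feature i)) measurable_const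

lemma measurable_postCross (a : Fin K) (t : Fin d → ℝ) (b : Fin K) :
    Measurable fun s : Sample 𝒳 K n => M.postCross s a t b := by
  refine measurable_matrix_mulVec (M.measurable_condCov_apply b) (Measurable.const_add ?_ _)
  refine measurable_matrix_mulVec (fun _ _ => measurable_const)
    (measurable_matrix_mulVec (fun _ _ => measurable_const) ?_)
  refine measurable_matrix_mulVec M.measurable_latentPostCov_apply ?_
  refine measurable_matrix_mulVec (fun _ _ => measurable_const)
    (measurable_matrix_mulVec (fun _ _ => measurable_const) ?_)
  exact measurable_matrix_mulVec (M.measurable_condCov_apply a) measurable_const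

lemma measurable_regCoef (a : Fin K) (t : Fin d → ℝ) :
    Measurable fun s : Sample 𝒳 K n => M.regCoef s a t := by
  refine measurable_pi_lambda _ fun i => Measurable.const_mul ?_ _
  refine measurable_dotProduct (M.measurable_feature i) ?_
  -- The action index itself depends on the sample; summing over all actions with indicators makes
  -- it constant in each term.
  have h : ∀ s : Sample 𝒳 K n, M.postCross s a t (s i).2.1 =
      ∑ b, if (s i).2.1 = b then M.postCross s a t b else 0 := fun s => by simp
  simp only [h]
  exact Finset.measurable_sum _ fun b _ => Measurable.ite (measurableSet_action_eq i b)
    (M.measurable_postCross a t b) measurable_const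

lemma measurable_latentCoef {c : Sample 𝒳 K n → Fin K → Fin d → ℝ} (hc : Measurable c) :
    Measurable fun s : Sample 𝒳 K n => M.latentCoef (c s) := by
  refine Finset.measurable_sum _ fun b _ => ?_
  exact measurable_matrix_mulVec (fun _ _ => measurable_const) ((measurable_pi_apply b).comp hc)

lemma measurable_residCoef (a : Fin K) (t : Fin d → ℝ) :
    Measurable fun s : Sample 𝒳 K n => M.residCoef s a t := by
  refine Measurable.const_sub (measurable_pi_lambda _ fun b => ?_) _
  exact M.measurable_featureCoef (M.measurable_regCoef a t) b

end Model

/-! ### Characteristic functions of the parameters and the rewards, given the design. -/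

lemma integral_pi_exp_sum_mul_I {ι : Type*} [Fintype ι] {E : ι → Type*}
    [∀ i, MeasurableSpace (E i)] (ν : ∀ i, Measure (E i)) [∀ i, IsProbabilityMeasure (ν i)]
    (f : ∀ i, E i → ℝ) :
    ∫ z, Complex.exp ((∑ i, f i (z i) : ℝ) * Complex.I) ∂(Measure.pi ν) =
      ∏ i, ∫ z, Complex.exp ((f i z : ℝ) * Complex.I) ∂(ν i) := by
  rw [← integral_fintype_prod_eq_prod]
  simp [Finset.sum_mul, Complex.exp_sum]

lemma integral_gaussianReal_exp_mul_I (m v c : ℝ) (hv : 0 ≤ v) :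
    ∫ r, Complex.exp ((c * r : ℝ) * Complex.I) ∂(gaussianReal m v.toNNReal) =
      Complex.exp ((c * m : ℝ) * Complex.I - (v * c ^ 2 : ℝ) / 2) := by
  have h := charFun_gaussianReal (μ := m) (v := v.toNNReal) c
  rw [charFun_apply_real] at h
  simpa [hv] using h

lemma norm_exp_neg_ofReal_div_two_le {q : ℝ} (hq : 0 ≤ q) :
    ‖Complex.exp (-((q : ℂ) / 2))‖ ≤ 1 := by
  have e : -((q : ℂ) / 2) = ((-(q / 2) : ℝ) : ℂ) := by push_cast; ring
  rw [e, Complex.norm_exp_ofReal]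
  exact Real.exp_le_one_iff.2 (by linarith)

/-- The sample with design `ξ` and rewards `r`. -/
def sampleOf {𝒳 : Type*} {K n : ℕ} (ξ : (Fin n → 𝒳) × (Fin n → Fin K)) (r : Fin n → ℝ) :
    Sample 𝒳 K n := fun i => (ξ.1 i, ξ.2 i, r i)

lemma measurable_sampleOf {𝒳 : Type*} [MeasurableSpace 𝒳] {K n : ℕ} :
    Measurable fun p : ((Fin n → 𝒳) × (Fin n → Fin K)) × (Fin n → ℝ) => sampleOf p.1 p.2 := by
  unfold sampleOf
  fun_prop

namespace Model

variable {𝒳 : Type*} [MeasurableSpace 𝒳] {K d d' n : ℕ} (M : Model 𝒳 K d d')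

/-- The conditional characteristic function of the rewards given the parameters and the design. -/
lemma integral_exp_rewards (w : ℂ) (ξ : (Fin n → 𝒳) × (Fin n → Fin K)) (v : Fin n → ℝ)
    (c : Fin K → Fin d → ℝ) (z : Fin K → EuclideanSpace ℝ (Fin d)) :
    ∫ r : Fin n → ℝ, w * Complex.exp ((∑ b, c b ⬝ᵥ (z b).ofLp +
          ∑ i, v i * r i : ℝ) * Complex.I)
        ∂(Measure.pi fun i => M.rewardLaw (ξ.1 i) (z (ξ.2 i))) =
      w * Complex.exp (-((M.σ ^ 2 * ∑ i, v i ^ 2 : ℝ) / 2)) *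
        Complex.exp ((∑ b, (c + M.featureCoef (sampleOf ξ 0) v) b ⬝ᵥ (z b).ofLp : ℝ) *
          Complex.I) := by
  -- `featureCoef` reads only the contexts and actions, so the rewards of the sample can be set to
  -- `0`.
  have hfeat : ∑ i, v i * ((M.φ (ξ.1 i)).ofLp ⬝ᵥ (z (ξ.2 i)).ofLp) =
      ∑ b, M.featureCoef (sampleOf ξ 0) v b ⬝ᵥ (z b).ofLp :=
    (M.sum_featureCoef_dotProduct (sampleOf ξ 0) v fun b => (z b).ofLp).symm
  have hsplit : ∀ r : Fin n → ℝ, w * Complex.exp ((∑ b, c b ⬝ᵥ (z b).ofLp +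
      ∑ i, v i * r i : ℝ) * Complex.I) =
      w * Complex.exp ((∑ b, c b ⬝ᵥ (z b).ofLp : ℝ) * Complex.I) *
        Complex.exp ((∑ i, v i * r i : ℝ) * Complex.I) := fun r => by
    rw [mul_assoc, ← Complex.exp_add]; push_cast; ring_nf
  simp only [hsplit, rewardLaw]
  rw [integral_const_mul, integral_pi_exp_sum_mul_I _ fun i (r : ℝ) => v i * r]
  simp only [integral_gaussianReal_exp_mul_I _ _ _ (sq_nonneg M.σ), ← Complex.exp_sum]
  rw [mul_assoc, mul_assoc, ← Complex.exp_add, ← Complex.exp_add]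
  congr 2
  simp only [Pi.add_apply, add_dotProduct, Finset.sum_add_distrib, ← hfeat]
  push_cast
  rw [Finset.sum_sub_distrib, Finset.sum_mul, Finset.mul_sum, Finset.sum_div]
  simp only [Finset.sum_mul, add_mul]
  ring

namespace WellSpecified

variable {M} {Ω : Type*} [MeasurableSpace Ω] {P : Measure Ω} [IsProbabilityMeasure P]
  {ψ : Ω → EuclideanSpace ℝ (Fin d')} {θ : Ω → Fin K → EuclideanSpace ℝ (Fin d)}
  {X : Ω → Fin n → 𝒳} {A : Ω → Fin n → Fin K} {R : Ω → Fin n → ℝ}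

/-- The characteristic function of the prior of the action parameters. -/
lemma integral_exp_action (hM : M.WellSpecified P ψ θ X A R) (c : Fin K → Fin d → ℝ) :
    ∫ ω, Complex.exp ((∑ b, c b ⬝ᵥ (θ ω b).ofLp : ℝ) * Complex.I) ∂P =
      Complex.exp ((M.latentCoef c ⬝ᵥ M.μ.ofLp : ℝ) * Complex.I - (M.priorVar c : ℝ) / 2) := by
  have hF : Measurable fun p : EuclideanSpace ℝ (Fin d') × (Fin K → EuclideanSpace ℝ (Fin d)) =>
      Complex.exp ((∑ b, c b ⬝ᵥ (p.2 b).ofLp : ℝ) * Complex.I) := by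
    simp only [dotProduct]; fun_prop
  rw [integral_eq_integral_condDistrib hM.measurable_ψ hM.measurable_θ hM.law_action hF (c := 1)
    (fun p => (Complex.norm_exp_ofReal_mul_I _).le)]
  have hin : ∀ p : EuclideanSpace ℝ (Fin d'),
      ∫ z : Fin K → EuclideanSpace ℝ (Fin d),
        Complex.exp ((∑ b, c b ⬝ᵥ (z b).ofLp : ℝ) * Complex.I) ∂(Measure.pi fun a =>
          multivariateGaussian (WithLp.toLp 2 ((M.W a).mulVec p.ofLp)) (M.actionCov a)) =
        Complex.exp (-((∑ b, c b ⬝ᵥ M.actionCov b *ᵥ c b : ℝ) / 2)) *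
          Complex.exp ((M.latentCoef c ⬝ᵥ p.ofLp : ℝ) * Complex.I) := fun p => by
    rw [integral_pi_exp_sum_mul_I _ fun b (z : EuclideanSpace ℝ (Fin d)) => c b ⬝ᵥ z.ofLp]
    simp only [charFun_multivariateGaussian_dotProduct _ (M.posDef_actionCov _).posSemidef,
      ← Complex.exp_sum, ← Complex.exp_add, latentCoef_dotProduct]
    congr 1
    push_cast
    rw [Finset.sum_sub_distrib, Finset.sum_mul, Finset.sum_div]
    ring
  simp only [hin]
  rw [integral_const_mul, ← integral_map (φ := ψ) (f := fun p : EuclideanSpace ℝ (Fin d') =>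
    Complex.exp ((M.latentCoef c ⬝ᵥ p.ofLp : ℝ) * Complex.I)) hM.measurable_ψ.aemeasurable
    (by simp only [dotProduct]; exact Measurable.aestronglyMeasurable (by fun_prop)),
    hM.law_latent, charFun_multivariateGaussian_dotProduct _ M.posDef_latentCov.posSemidef,
    ← Complex.exp_add, priorVar]
  congr 1
  push_cast
  ring

/-- The joint characteristic function of an action parameter and the rewards, given the design. -/
lemma integral_exp_action_rewards (hM : M.WellSpecified P ψ θ X A R)
    {w : (Fin n → 𝒳) × (Fin n → Fin K) → ℂ} (hw : Measurable w) {k : ℝ} (hk : ∀ ξ, ‖w ξ‖ ≤ k)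
    {v : (Fin n → 𝒳) × (Fin n → Fin K) → Fin n → ℝ} (hv : Measurable v)
    (c : Fin K → Fin d → ℝ) :
    ∫ ω, w (X ω, A ω) * Complex.exp ((∑ b, c b ⬝ᵥ (θ ω b).ofLp +
        ∑ i, v (X ω, A ω) i * R ω i : ℝ) * Complex.I) ∂P =
      ∫ ω, w (X ω, A ω) * Complex.exp
        ((M.latentCoef (c + M.featureCoef (sampleOf (X ω, A ω) 0) (v (X ω, A ω))) ⬝ᵥ M.μ.ofLp : ℝ) *
          Complex.I - (M.jointVar (sampleOf (X ω, A ω) 0) c (v (X ω, A ω)) : ℝ) / 2) ∂P := by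
  have hvi : ∀ i, Measurable fun ξ => v ξ i := fun i => (measurable_pi_apply i).comp hv
  have hF : Measurable fun p : (EuclideanSpace ℝ (Fin d') × (Fin K → EuclideanSpace ℝ (Fin d)) ×
      (Fin n → 𝒳) × (Fin n → Fin K)) × (Fin n → ℝ) =>
      w p.1.2.2 * Complex.exp ((∑ b, c b ⬝ᵥ (p.1.2.1 b).ofLp +
        ∑ i, v p.1.2.2 i * p.2 i : ℝ) * Complex.I) := by
    simp only [dotProduct]; fun_prop
  have h1 := integral_eq_integral_condDistrib (P := P)
    (X := fun ω => (ψ ω, θ ω, X ω, A ω)) (Y := R)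
    (hM.measurable_ψ.prodMk (hM.measurable_θ.prodMk (hM.measurable_X.prodMk hM.measurable_A)))
    hM.measurable_R hM.law_reward hF (c := k)
    (fun p => by rw [norm_mul, Complex.norm_exp_ofReal_mul_I, mul_one]; exact hk _)
  refine h1.trans ?_
  rw [integral_congr_ae (ae_of_all P fun ω => M.integral_exp_rewards (w (X ω, A ω)) (X ω, A ω)
    (v (X ω, A ω)) c (θ ω))]
  have hfc : ∀ b, Measurable fun ξ => M.featureCoef (sampleOf ξ 0) (v ξ) b := fun b => by
    have := (M.measurable_featureCoef (v := fun s => v (fun i => (s i).1, fun i => (s i).2.1))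
      (hv.comp (by fun_prop)) b).comp
        (measurable_sampleOf.comp (measurable_id.prodMk (measurable_const (a := (0 : Fin n → ℝ)))))
    exact this
  have hH : Measurable fun p : (EuclideanSpace ℝ (Fin d') × (Fin K → EuclideanSpace ℝ (Fin d))) ×
      ((Fin n → 𝒳) × (Fin n → Fin K)) =>
      w p.2 * Complex.exp (-((M.σ ^ 2 * ∑ i, v p.2 i ^ 2 : ℝ) / 2)) *
        Complex.exp ((∑ b, (c + M.featureCoef (sampleOf p.2 0) (v p.2)) b ⬝ᵥ (p.1.2 b).ofLp : ℝ) *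
          Complex.I) := by
    refine Measurable.mul (by fun_prop)
      (Complex.measurable_exp.comp ((Complex.measurable_ofReal.comp ?_).mul_const _))
    exact Finset.measurable_sum _ fun b _ => measurable_dotProduct
      (((hfc b).comp measurable_snd).const_add _) (by fun_prop)
  have hξ : Measurable fun ω => (X ω, A ω) := hM.measurable_X.prodMk hM.measurable_A
  have hψθ : Measurable fun ω => (ψ ω, θ ω) := hM.measurable_ψ.prodMk hM.measurable_θ
  have hind := (indepFun_iff_map_prod_eq_prod_map_map hψθ.aemeasurable hξ.aemeasurable).1
    hM.indep_design
  have hnorm : ∀ ξ, ‖w ξ * Complex.exp (-((M.σ ^ 2 * ∑ i, v ξ i ^ 2 : ℝ) / 2))‖ ≤ k := fun ξ => by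
    rw [norm_mul]
    exact (mul_le_of_le_one_right (norm_nonneg _)
      (norm_exp_neg_ofReal_div_two_le (by positivity))).trans (hk ξ)
  have h2 := integral_map (μ := P) (hψθ.prodMk hξ).aemeasurable hH.aestronglyMeasurable
  simp only at h2
  have := Measure.isProbabilityMeasure_map (μ := P) hψθ.aemeasurable
  have := Measure.isProbabilityMeasure_map (μ := P) hξ.aemeasurable
  -- Independence of the design makes the joint law a product, so the parameters are integrated
  -- first with the design held fixed.
  rw [← h2, hind, integral_prod_symm _ (Integrable.of_bound hH.aestronglyMeasurable k
    (ae_of_all _ fun p => by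
      rw [norm_mul, Complex.norm_exp_ofReal_mul_I, mul_one]; exact hnorm _))]
  have hin2 : ∀ ξ : (Fin n → 𝒳) × (Fin n → Fin K),
      ∫ p : EuclideanSpace ℝ (Fin d') × (Fin K → EuclideanSpace ℝ (Fin d)),
        w ξ * Complex.exp (-((M.σ ^ 2 * ∑ i, v ξ i ^ 2 : ℝ) / 2)) *
        Complex.exp ((∑ b, (c + M.featureCoef (sampleOf ξ 0) (v ξ)) b ⬝ᵥ (p.2 b).ofLp : ℝ) *
          Complex.I) ∂(P.map fun ω => (ψ ω, θ ω)) =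
      w ξ * Complex.exp ((M.latentCoef (c + M.featureCoef (sampleOf ξ 0) (v ξ)) ⬝ᵥ M.μ.ofLp : ℝ) *
          Complex.I - (M.jointVar (sampleOf ξ 0) c (v ξ) : ℝ) / 2) := fun ξ => by
    rw [integral_const_mul, integral_map hψθ.aemeasurable
      (by simp only [dotProduct]; exact Measurable.aestronglyMeasurable (by fun_prop)),
      hM.integral_exp_action, mul_assoc, ← Complex.exp_add, jointVar]
    congr 2
    push_cast
    ring
  simp only [hin2]
  have hm2 : AEStronglyMeasurable (fun ξ => w ξ * Complex.exp
      ((M.latentCoef (c + M.featureCoef (sampleOf ξ 0) (v ξ)) ⬝ᵥ M.μ.ofLp : ℝ) *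
          Complex.I - (M.jointVar (sampleOf ξ 0) c (v ξ) : ℝ) / 2))
      (P.map fun ω => (X ω, A ω)) := by
    simp only [← hin2]
    exact (hH.stronglyMeasurable.integral_prod_left').aestronglyMeasurable
  rw [integral_map hξ.aemeasurable hm2]

end WellSpecified
end Model

lemma exists_dotProduct_repr {n d : ℕ} (L : StrongDual ℝ ((Fin n → ℝ) × EuclideanSpace ℝ (Fin d))) :
    ∃ (u : Fin n → ℝ) (t : Fin d → ℝ), ∀ p, L p = t ⬝ᵥ p.2.ofLp + ∑ i, u i * p.1 i := by
  refine ⟨fun i => L (Pi.single i 1, 0), fun j => L (0, EuclideanSpace.single j 1), fun p => ?_⟩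
  have h1 : p.1 = ∑ i, p.1 i • (Pi.single i 1 : Fin n → ℝ) := by
    ext i; simp [Finset.sum_apply, Pi.single_apply]
  have h2 : p.2 = ∑ j, p.2 j • EuclideanSpace.single j (1 : ℝ) := by
    ext i; simp [Pi.single_apply]
  have hL1 : L (p.1, 0) = ∑ i, L (Pi.single i 1, 0) * p.1 i := by
    have : L (p.1, 0) =
        (L ∘L ContinuousLinearMap.inl ℝ (Fin n → ℝ) (EuclideanSpace ℝ (Fin d))) p.1 := by
      simp
    rw [this]; conv_lhs => rw [h1]
    rw [map_sum]
    simp [mul_comm]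
  have hL2 : L (0, p.2) = ∑ j, L (0, EuclideanSpace.single j 1) * p.2 j := by
    have : L (0, p.2) =
        (L ∘L ContinuousLinearMap.inr ℝ (Fin n → ℝ) (EuclideanSpace ℝ (Fin d))) p.2 := by
      simp
    rw [this]; conv_lhs => rw [h2]
    rw [map_sum]
    simp [mul_comm]
  have : L p = L (0, p.2) + L (p.1, 0) := by rw [← map_add]; simp
  rw [this, hL1, hL2]
  rfl

/-! ### The joint law of the sample and the residual, and the posterior. -/

namespace Model

variable {𝒳 : Type*} [MeasurableSpace 𝒳] {K d d' n : ℕ} (M : Model 𝒳 K d d')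

/-- The posterior kernel of the residual `θ_a - μ̂_a`. -/
def residKernel (n : ℕ) (a : Fin K) :
    Kernel (Sample 𝒳 K n) (EuclideanSpace ℝ (Fin d)) :=
  gaussianKernel (fun _ => 0) (fun s => M.postCov s a) measurable_const
    (M.measurable_postCov_apply a) fun s => (M.posDef_postCov s a).posSemidef

instance (n : ℕ) (a : Fin K) : IsMarkovKernel (M.residKernel n a) := by
  unfold residKernel; infer_instance

namespace WellSpecified

variable {M} {Ω : Type*} [MeasurableSpace Ω] {P : Measure Ω} [IsProbabilityMeasure P]
  {ψ : Ω → EuclideanSpace ℝ (Fin d')} {θ : Ω → Fin K → EuclideanSpace ℝ (Fin d)}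
  {X : Ω → Fin n → 𝒳} {A : Ω → Fin n → Fin K} {R : Ω → Fin n → ℝ}

/-- The residual `θ_a - μ̂_a` is, given the design, independent of the rewards, with law
`N(0, Σ̂_a)`; in terms of characteristic functions. -/
lemma integral_exp_resid (hM : M.WellSpecified P ψ θ X A R) (a : Fin K)
    {D : Set ((Fin n → 𝒳) × (Fin n → Fin K))} (hD : MeasurableSet D) (t : Fin d → ℝ)
    (u : Fin n → ℝ) :
    ∫ ω, D.indicator 1 (X ω, A ω) * Complex.exp
        ((t ⬝ᵥ (θ ω a - M.postMean (sample X A R ω) a).ofLp + ∑ i, u i * R ω i : ℝ) * Complex.I)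
          ∂P =
      ∫ ω, D.indicator 1 (X ω, A ω) * Complex.exp (-((t ⬝ᵥ M.postCov (sample X A R ω) a *ᵥ t : ℝ) /
        2)) * Complex.exp ((∑ i, u i * R ω i : ℝ) * Complex.I) ∂P := by
  have hs0 : Measurable fun ξ : (Fin n → 𝒳) × (Fin n → Fin K) => sampleOf ξ (0 : Fin n → ℝ) :=
    measurable_sampleOf.comp (measurable_id.prodMk measurable_const)
  have hDm : Measurable (D.indicator (1 : (Fin n → 𝒳) × (Fin n → Fin K) → ℂ)) :=
    measurable_one.indicator hD
  have hDn : ∀ ξ, ‖D.indicator (1 : (Fin n → 𝒳) × (Fin n → Fin K) → ℂ) ξ‖ ≤ 1 := fun ξ => by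
    by_cases h : ξ ∈ D <;> simp [h]
  have hg : Measurable fun ξ : (Fin n → 𝒳) × (Fin n → Fin K) =>
      M.latentCoef (M.residCoef (sampleOf ξ 0) a t) ⬝ᵥ M.μ.ofLp :=
    measurable_dotProduct ((M.measurable_latentCoef (M.measurable_residCoef a t)).comp hs0)
      measurable_const
  have hq : Measurable fun ξ : (Fin n → 𝒳) × (Fin n → Fin K) =>
      t ⬝ᵥ M.postCov (sampleOf ξ 0) a *ᵥ t :=
    measurable_dotProduct measurable_const ((measurable_matrix_mulVec
      (M.measurable_postCov_apply a) measurable_const).comp hs0)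
  -- The phase in `w` removes the constant term of the posterior mean, and the shift of `v` by
  -- `regCoef` removes its part linear in the rewards.
  have h1 := hM.integral_exp_action_rewards
    (w := fun ξ => D.indicator 1 ξ * Complex.exp
      ((-(M.latentCoef (M.residCoef (sampleOf ξ 0) a t) ⬝ᵥ M.μ.ofLp) : ℝ) * Complex.I))
    (by fun_prop) (k := 1)
    (fun ξ => by rw [norm_mul, Complex.norm_exp_ofReal_mul_I, mul_one]; exact hDn ξ)
    (v := fun ξ => u - M.regCoef (sampleOf ξ 0) a t)
    (((M.measurable_regCoef a t).comp hs0).const_sub u) (Pi.single a t)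
  have h2 := hM.integral_exp_action_rewards
    (w := fun ξ => D.indicator 1 ξ * Complex.exp
      (-((t ⬝ᵥ M.postCov (sampleOf ξ 0) a *ᵥ t : ℝ) / 2)))
    (by fun_prop) (k := 1)
    (fun ξ => by
      rw [norm_mul]
      exact mul_le_one₀ (hDn ξ) (norm_nonneg _) (norm_exp_neg_ofReal_div_two_le
        (by simpa using (M.posDef_postCov (sampleOf ξ 0) a).posSemidef.dotProduct_mulVec_nonneg t)))
    (v := fun _ => u) measurable_const 0
  have hl : ∀ ω, D.indicator 1 (X ω, A ω) * Complex.exp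
        ((t ⬝ᵥ (θ ω a - M.postMean (sample X A R ω) a).ofLp + ∑ i, u i * R ω i : ℝ) * Complex.I) =
      D.indicator 1 (X ω, A ω) * Complex.exp
        ((-(M.latentCoef (M.residCoef (sampleOf (X ω, A ω) 0) a t) ⬝ᵥ M.μ.ofLp) : ℝ) * Complex.I) *
        Complex.exp ((∑ b, (Pi.single a t : Fin K → Fin d → ℝ) b ⬝ᵥ (θ ω b).ofLp +
          ∑ i, (u - M.regCoef (sampleOf (X ω, A ω) 0) a t) i * R ω i : ℝ) *
            Complex.I) := fun ω => by
    have hmean : t ⬝ᵥ (M.postMean (sample X A R ω) a).ofLp =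
        M.latentCoef (M.residCoef (sampleOf (X ω, A ω) 0) a t) ⬝ᵥ M.μ.ofLp +
          ∑ i, M.regCoef (sampleOf (X ω, A ω) 0) a t i * R ω i :=
      M.dotProduct_postMean (sample X A R ω) a t
    have hsingle : ∑ b, (Pi.single a t : Fin K → Fin d → ℝ) b ⬝ᵥ (θ ω b).ofLp =
        t ⬝ᵥ (θ ω a).ofLp :=
      sum_single_dotProduct a t fun b => (θ ω b).ofLp
    rw [mul_assoc, ← Complex.exp_add, WithLp.ofLp_sub, dotProduct_sub, hmean, hsingle]
    simp only [Pi.sub_apply, sub_mul, Finset.sum_sub_distrib]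
    congr 2
    push_cast
    ring
  have hr : ∀ ω, D.indicator 1 (X ω, A ω) * Complex.exp (-((t ⬝ᵥ M.postCov (sample X A R ω) a *ᵥ t :
      ℝ) / 2)) * Complex.exp ((∑ i, u i * R ω i : ℝ) * Complex.I) =
      D.indicator 1 (X ω, A ω) * Complex.exp
        (-((t ⬝ᵥ M.postCov (sampleOf (X ω, A ω) (0 : Fin n → ℝ)) a *ᵥ t : ℝ) / 2)) *
        Complex.exp ((∑ b, (0 : Fin K → Fin d → ℝ) b ⬝ᵥ (θ ω b).ofLp +
          ∑ i, u i * R ω i : ℝ) * Complex.I) := fun ω => by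
    -- The posterior covariance does not depend on the rewards, so it is an admissible design
    -- weight.
    have : M.postCov (sample X A R ω) a = M.postCov (sampleOf (X ω, A ω) (0 : Fin n → ℝ)) a := rfl
    rw [this]; simp
  refine ((integral_congr_ae (ae_of_all P hl)).trans h1).trans
    (Eq.trans ?_ (((integral_congr_ae (ae_of_all P hr)).trans h2)).symm)
  refine integral_congr_ae (ae_of_all P fun ω => ?_)
  simp only
  -- The two phases in the mean of the residual cancel, and the variance splits into posterior
  -- variance plus variance of the reward functional: this is the independence.
  rw [residCoef_add_featureCoef, jointVar_sub_regCoef, latentCoef_add, zero_add, mul_assoc,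
    mul_assoc, ← Complex.exp_add, ← Complex.exp_add, add_dotProduct]
  congr 2
  push_cast
  ring

lemma measurable_sample (hM : M.WellSpecified P ψ θ X A R) : Measurable (sample X A R) :=
  measurable_sampleOf.comp ((hM.measurable_X.prodMk hM.measurable_A).prodMk hM.measurable_R)

lemma measurable_resid (hM : M.WellSpecified P ψ θ X A R) (a : Fin K) :
    Measurable fun ω => θ ω a - M.postMean (sample X A R ω) a :=
  ((measurable_pi_apply a).comp hM.measurable_θ).sub
    ((M.measurable_postMean a).comp hM.measurable_sample)

/-- The joint law of the sample and the residual `θ_a - μ̂_a`. -/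
lemma map_sample_resid (hM : M.WellSpecified P ψ θ X A R) (a : Fin K) :
    P.map (fun ω => (sample X A R ω, θ ω a - M.postMean (sample X A R ω) a)) =
      P.map (sample X A R) ⊗ₘ M.residKernel n a := by
  have hS := hM.measurable_sample
  have hZ := hM.measurable_resid a
  have := Measure.isProbabilityMeasure_map (μ := P) hS.aemeasurable
  have := Measure.isProbabilityMeasure_map (μ := P) (hS.prodMk hZ).aemeasurable
  -- The coordinates are regrouped so that the design, which lies in a bare measurable space, is
  -- tested by indicators, and the rewards and residual by characters. The left inverse `g` brings
  -- the equality of laws back.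
  let f : Sample 𝒳 K n × EuclideanSpace ℝ (Fin d) →
      ((Fin n → 𝒳) × (Fin n → Fin K)) × ((Fin n → ℝ) × EuclideanSpace ℝ (Fin d)) := fun p =>
    ((fun i => (p.1 i).1, fun i => (p.1 i).2.1), (fun i => (p.1 i).2.2, p.2))
  let g : ((Fin n → 𝒳) × (Fin n → Fin K)) × ((Fin n → ℝ) × EuclideanSpace ℝ (Fin d)) →
      Sample 𝒳 K n × EuclideanSpace ℝ (Fin d) := fun q => (sampleOf q.1 q.2.1, q.2.2)
  have hf : Measurable f := by unfold f; fun_prop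
  have hg : Measurable g := by unfold g sampleOf; fun_prop
  have hgf : g ∘ f = id := rfl
  suffices h : (P.map (fun ω => (sample X A R ω, θ ω a - M.postMean (sample X A R ω) a))).map f =
      (P.map (sample X A R) ⊗ₘ M.residKernel n a).map f by
    have h' := congrArg (Measure.map g) h
    rwa [Measure.map_map hg hf, Measure.map_map hg hf, hgf, Measure.map_id, Measure.map_id] at h'
  have := Measure.isProbabilityMeasure_map (μ := P.map fun ω =>
    (sample X A R ω, θ ω a - M.postMean (sample X A R ω) a)) hf.aemeasurable
  have := Measure.isProbabilityMeasure_map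
    (μ := P.map (sample X A R) ⊗ₘ M.residKernel n a) hf.aemeasurable
  refine measure_prod_ext_of_charFunDual fun D hD L => ?_
  obtain ⟨u, t, hL⟩ := exists_dotProduct_repr L
  have hDm : Measurable (D.indicator (1 : (Fin n → 𝒳) × (Fin n → Fin K) → ℂ)) :=
    measurable_one.indicator hD
  have hF : Measurable fun p : ((Fin n → 𝒳) × (Fin n → Fin K)) ×
      ((Fin n → ℝ) × EuclideanSpace ℝ (Fin d)) =>
      D.indicator (1 : (Fin n → 𝒳) × (Fin n → Fin K) → ℂ) p.1 *
        Complex.exp (L p.2 * Complex.I) := by fun_prop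
  have hFf : Measurable fun p => D.indicator (1 : (Fin n → 𝒳) × (Fin n → Fin K) → ℂ) (f p).1 *
      Complex.exp (L (f p).2 * Complex.I) := hF.comp hf
  have hFb : ∀ p : ((Fin n → 𝒳) × (Fin n → Fin K)) × ((Fin n → ℝ) × EuclideanSpace ℝ (Fin d)),
      ‖D.indicator (1 : (Fin n → 𝒳) × (Fin n → Fin K) → ℂ) p.1 *
        Complex.exp (L p.2 * Complex.I)‖ ≤ 1 := fun p => by
    rw [norm_mul, Complex.norm_exp_ofReal_mul_I, mul_one]
    by_cases h : p.1 ∈ D <;> simp [h]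
  rw [integral_map hf.aemeasurable hF.aestronglyMeasurable,
    integral_map (hS.prodMk hZ).aemeasurable hFf.aestronglyMeasurable,
    integral_map hf.aemeasurable hF.aestronglyMeasurable,
    Measure.integral_compProd (Integrable.of_bound hFf.aestronglyMeasurable 1
      (ae_of_all _ fun p => hFb (f p))),
    integral_map hS.aemeasurable
      hFf.stronglyMeasurable.integral_kernel_prod_right'.aestronglyMeasurable]
  simp only [hL]
  refine (hM.integral_exp_resid a hD t u).trans ?_
  refine integral_congr_ae (ae_of_all P fun ω => ?_)
  have hsplit : ∀ z : EuclideanSpace ℝ (Fin d),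
      D.indicator (1 : (Fin n → 𝒳) × (Fin n → Fin K) → ℂ) (X ω, A ω) *
        Complex.exp ((t ⬝ᵥ z.ofLp + ∑ i, u i * R ω i : ℝ) * Complex.I) =
      D.indicator (1 : (Fin n → 𝒳) × (Fin n → Fin K) → ℂ) (X ω, A ω) *
        Complex.exp ((∑ i, u i * R ω i : ℝ) * Complex.I) *
        Complex.exp ((t ⬝ᵥ z.ofLp : ℝ) * Complex.I) := fun z => by
    rw [mul_assoc, ← Complex.exp_add]; push_cast; ring_nf
  have hint : ∫ z, D.indicator (1 : (Fin n → 𝒳) × (Fin n → Fin K) → ℂ) (X ω, A ω) *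
        Complex.exp ((t ⬝ᵥ z.ofLp + ∑ i, u i * R ω i : ℝ) * Complex.I)
          ∂(multivariateGaussian 0 (M.postCov (sample X A R ω) a)) =
      D.indicator 1 (X ω, A ω) * Complex.exp (-((t ⬝ᵥ M.postCov (sample X A R ω) a *ᵥ t : ℝ) /
        2)) * Complex.exp ((∑ i, u i * R ω i : ℝ) * Complex.I) := by
    simp only [hsplit]
    rw [integral_const_mul, charFun_multivariateGaussian_dotProduct _
      (M.posDef_postCov _ a).posSemidef]
    simp only [WithLp.ofLp_zero, dotProduct_zero, Complex.ofReal_zero, zero_mul, zero_sub]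
    ring
  exact hint.symm

/-- The posterior law of `θ_a`. -/
lemma condDistrib_action (hM : M.WellSpecified P ψ θ X A R) (a : Fin K) :
    condDistrib (fun ω => θ ω a) (sample X A R) P =ᵐ[P.map (sample X A R)]
      fun s => multivariateGaussian (M.postMean s a) (M.postCov s a) := by
  have hS := hM.measurable_sample
  have hZ := hM.measurable_resid a
  have hθ : Measurable fun ω => θ ω a := (measurable_pi_apply a).comp hM.measurable_θ
  refine condDistrib_ae_eq_of_measure_eq_compProd_of_measurable hS hθ
    (κ := gaussianKernel (fun s => M.postMean s a) (fun s => M.postCov s a)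
      (M.measurable_postMean a) (M.measurable_postCov_apply a)
      fun s => (M.posDef_postCov s a).posSemidef) ?_
  -- Adding the posterior mean recovers `θ_a` from the residual; in each fibre it translates `N(0,
  -- Σ̂_a)` to `N(μ̂_a, Σ̂_a)`.
  have hsh : Measurable fun p : Sample 𝒳 K n × EuclideanSpace ℝ (Fin d) =>
      (p.1, M.postMean p.1 a + p.2) :=
    measurable_fst.prodMk (((M.measurable_postMean a).comp measurable_fst).add measurable_snd)
  have h := congrArg (Measure.map fun p : Sample 𝒳 K n × EuclideanSpace ℝ (Fin d) =>
    (p.1, M.postMean p.1 a + p.2)) (hM.map_sample_resid a)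
  rw [Measure.map_map hsh (hS.prodMk hZ)] at h
  have hcomp : ((fun p : Sample 𝒳 K n × EuclideanSpace ℝ (Fin d) =>
      (p.1, M.postMean p.1 a + p.2)) ∘ fun ω =>
        (sample X A R ω, θ ω a - M.postMean (sample X A R ω) a)) =
      fun ω => (sample X A R ω, θ ω a) := by
    funext ω; simp
  rw [← hcomp, h]
  have := Measure.isProbabilityMeasure_map (μ := P) hS.aemeasurable
  ext V hV
  rw [Measure.map_apply hsh hV, Measure.compProd_apply (hsh hV), Measure.compProd_apply hV]
  refine lintegral_congr fun s => ?_
  change multivariateGaussian 0 (M.postCov s a) _ =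
    multivariateGaussian (M.postMean s a) (M.postCov s a) _
  have hV' := measurable_prodMk_left (x := s) hV
  rw [multivariateGaussian, multivariateGaussian, Measure.map_apply (by fun_prop) hV',
    Measure.map_apply (by fun_prop) (measurable_prodMk_left (x := s) (hsh hV))]
  simp only [zero_add]
  rfl

end WellSpecified

/-! ### Projection on a feature vector and second moments of the residual. -/

lemma weightedNorm_postCov_sq (s : Sample 𝒳 K n) (a : Fin K) (v : EuclideanSpace ℝ (Fin d)) :
    weightedNorm (M.postCov s a) v ^ 2 = v.ofLp ⬝ᵥ M.postCov s a *ᵥ v.ofLp :=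
  Real.sq_sqrt (by simpa using (M.posDef_postCov s a).posSemidef.dotProduct_mulVec_nonneg v.ofLp)

lemma reward_eq (x : 𝒳) (a : Fin K) (θ : Fin K → EuclideanSpace ℝ (Fin d)) :
    M.reward x a θ = (M.φ x).ofLp ⬝ᵥ (θ a).ofLp := by
  rw [reward, rewardLaw, integral_id_gaussianReal]

lemma measurable_weightedNorm_postCov_sq (a : Fin K) (v : EuclideanSpace ℝ (Fin d)) :
    Measurable fun s : Sample 𝒳 K n => weightedNorm (M.postCov s a) v ^ 2 := by
  simp only [weightedNorm_postCov_sq]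
  exact measurable_dotProduct measurable_const
    (measurable_matrix_mulVec (M.measurable_postCov_apply a) measurable_const)

lemma integrable_weightedNorm_postCov_sq (a : Fin K) (v : EuclideanSpace ℝ (Fin d))
    (Q : Measure (Sample 𝒳 K n)) [IsFiniteMeasure Q] :
    Integrable (fun s => weightedNorm (M.postCov s a) v ^ 2) Q := by
  refine Integrable.of_bound (M.measurable_weightedNorm_postCov_sq a v).aestronglyMeasurable
    (M.priorVar (Pi.single a v.ofLp)) (ae_of_all _ fun s => ?_)
  rw [Real.norm_of_nonneg (sq_nonneg _), weightedNorm_postCov_sq]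
  exact M.dotProduct_postCov_mulVec_le s a v.ofLp

lemma integral_sq_gaussianReal_zero (v : NNReal) : ∫ r, r ^ 2 ∂(gaussianReal 0 v) = v := by
  have h := variance_id_gaussianReal (μ := 0) (v := v)
  rw [variance_of_integral_eq_zero aemeasurable_id (by simp)] at h
  simpa using h

lemma integrable_sq_gaussianReal (m : ℝ) (v : NNReal) :
    Integrable (fun r : ℝ => r ^ 2) (gaussianReal m v) :=
  (memLp_id_gaussianReal (μ := m) (v := v) 2).integrable_sq

lemma map_dotProduct_residKernel (s : Sample 𝒳 K n) (a : Fin K) (v : EuclideanSpace ℝ (Fin d)) :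
    (M.residKernel n a s).map (fun z => v.ofLp ⬝ᵥ z.ofLp) =
      gaussianReal 0 (weightedNorm (M.postCov s a) v ^ 2).toNNReal := by
  have h := map_dotProduct_multivariateGaussian 0 (M.posDef_postCov s a).posSemidef v
  rw [weightedNorm_postCov_sq]
  rw [WithLp.ofLp_zero, dotProduct_zero] at h
  exact h

lemma integrable_sq_dotProduct_residKernel (s : Sample 𝒳 K n) (a : Fin K)
    (v : EuclideanSpace ℝ (Fin d)) :
    Integrable (fun z => (v.ofLp ⬝ᵥ z.ofLp) ^ 2) (M.residKernel n a s) := by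
  have h := integrable_sq_gaussianReal 0 (weightedNorm (M.postCov s a) v ^ 2).toNNReal
  rw [← map_dotProduct_residKernel, integrable_map_measure
    (Measurable.aestronglyMeasurable (by fun_prop))
    (by simp only [dotProduct]; exact Measurable.aemeasurable (by fun_prop))] at h
  exact h

lemma integral_sq_dotProduct_residKernel (s : Sample 𝒳 K n) (a : Fin K)
    (v : EuclideanSpace ℝ (Fin d)) :
    ∫ z, (v.ofLp ⬝ᵥ z.ofLp) ^ 2 ∂(M.residKernel n a s) =
      weightedNorm (M.postCov s a) v ^ 2 := by
  have h := integral_sq_gaussianReal_zero (weightedNorm (M.postCov s a) v ^ 2).toNNReal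
  rwa [← map_dotProduct_residKernel, integral_map
    (by simp only [dotProduct]; exact Measurable.aemeasurable (by fun_prop))
    (Measurable.aestronglyMeasurable (by fun_prop)), Real.coe_toNNReal _ (sq_nonneg _)] at h

namespace WellSpecified

variable {M} {Ω : Type*} [MeasurableSpace Ω] {P : Measure Ω} [IsProbabilityMeasure P]
  {ψ : Ω → EuclideanSpace ℝ (Fin d')} {θ : Ω → Fin K → EuclideanSpace ℝ (Fin d)}
  {X : Ω → Fin n → 𝒳} {A : Ω → Fin n → Fin K} {R : Ω → Fin n → ℝ}

lemma condDistrib_dotProduct_action (hM : M.WellSpecified P ψ θ X A R) (a : Fin K)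
    (v : EuclideanSpace ℝ (Fin d)) :
    condDistrib (fun ω => v.ofLp ⬝ᵥ (θ ω a).ofLp) (sample X A R) P =ᵐ[P.map (sample X A R)]
      fun s => gaussianReal (v.ofLp ⬝ᵥ (M.postMean s a).ofLp)
        (weightedNorm (M.postCov s a) v ^ 2).toNNReal := by
  have hθ : Measurable fun ω => θ ω a := (measurable_pi_apply a).comp hM.measurable_θ
  have hdot : Measurable fun z : EuclideanSpace ℝ (Fin d) => v.ofLp ⬝ᵥ z.ofLp := by
    simp only [dotProduct]; fun_prop
  filter_upwards [condDistrib_comp (sample X A R) hθ.aemeasurable hdot (μ := P),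
    hM.condDistrib_action a] with s h1 h2
  refine h1.trans ?_
  rw [Kernel.map_apply _ hdot, h2, map_dotProduct_multivariateGaussian _
    (M.posDef_postCov s a).posSemidef, weightedNorm_postCov_sq]

lemma integrable_sq_dotProduct (hM : M.WellSpecified P ψ θ X A R) (a : Fin K)
    (v : EuclideanSpace ℝ (Fin d)) :
    Integrable (fun p : Sample 𝒳 K n × EuclideanSpace ℝ (Fin d) => (v.ofLp ⬝ᵥ p.2.ofLp) ^ 2)
      (P.map (sample X A R) ⊗ₘ M.residKernel n a) := by
  have := Measure.isProbabilityMeasure_map (μ := P) hM.measurable_sample.aemeasurable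
  rw [Measure.integrable_compProd_iff
    (by simp only [dotProduct]; exact Measurable.aestronglyMeasurable (by fun_prop))]
  refine ⟨ae_of_all _ fun s => M.integrable_sq_dotProduct_residKernel s a v, ?_⟩
  simp only [norm_pow, Real.norm_eq_abs, sq_abs, integral_sq_dotProduct_residKernel]
  exact M.integrable_weightedNorm_postCov_sq a v _

end WellSpecified
end Model

end StructuredBandit

end

theorem mainTheorem3 {𝒳 Ω : Type*} [MeasurableSpace 𝒳] [MeasurableSpace Ω] {K d d' n : ℕ}
    (M : StructuredBandit.Model 𝒳 K d d') (P : Measure Ω) [IsProbabilityMeasure P]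
    (ψ : Ω → EuclideanSpace ℝ (Fin d')) (θ : Ω → Fin K → EuclideanSpace ℝ (Fin d))
    (X : Ω → Fin n → 𝒳) (A : Ω → Fin n → Fin K) (R : Ω → Fin n → ℝ)
    (hM : M.WellSpecified P ψ θ X A R) (x : 𝒳) (a : Fin K) :
    -- the posterior covariance is positive definite
    (∀ s : StructuredBandit.Sample 𝒳 K n, (M.postCov s a).PosDef) ∧
    -- the law of the true action parameter given the sample
    (condDistrib (fun ω => θ ω a) (StructuredBandit.sample X A R) P
      =ᵐ[P.map (StructuredBandit.sample X A R)]
        fun s => multivariateGaussian (M.postMean s a) (M.postCov s a)) ∧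
    -- the law of its projection on the feature vector given the sample
    (condDistrib (fun ω => (M.φ x).ofLp ⬝ᵥ (θ ω a).ofLp) (StructuredBandit.sample X A R) P
      =ᵐ[P.map (StructuredBandit.sample X A R)]
        fun s => gaussianReal ((M.φ x).ofLp ⬝ᵥ (M.postMean s a).ofLp)
          (StructuredBandit.weightedNorm (M.postCov s a) (M.φ x) ^ 2).toNNReal) ∧
    -- the Bayesian mean squared error is finite and equals the expected squared weighted norm
    Integrable (fun ω => (M.rewardEstimate (StructuredBandit.sample X A R ω) x a -
      M.reward x a (θ ω)) ^ 2) P ∧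
    Integrable (fun ω => StructuredBandit.weightedNorm
      (M.postCov (StructuredBandit.sample X A R ω) a) (M.φ x) ^ 2) P ∧
    StructuredBandit.bayesianMSE M P (StructuredBandit.sample X A R) θ x a
        (fun s => M.rewardEstimate s x a) =
      ∫ ω, StructuredBandit.weightedNorm
        (M.postCov (StructuredBandit.sample X A R ω) a) (M.φ x) ^ 2 ∂P := by
  have hS := hM.measurable_sample
  have hSZ := hS.prodMk (hM.measurable_resid a)
  have := Measure.isProbabilityMeasure_map (μ := P) hS.aemeasurable
  -- The estimation error is, up to sign, the residual `θ_a - μ̂_a` projected on `φ(x)`.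
  have hsq : ∀ ω, (M.rewardEstimate (StructuredBandit.sample X A R ω) x a -
      M.reward x a (θ ω)) ^ 2 = ((M.φ x).ofLp ⬝ᵥ
        (θ ω a - M.postMean (StructuredBandit.sample X A R ω) a).ofLp) ^ 2 := fun ω => by
    rw [M.reward_eq, StructuredBandit.Model.rewardEstimate, WithLp.ofLp_sub,
      dotProduct_sub]
    ring
  have hint := hM.integrable_sq_dotProduct a (M.φ x)
  have hint' := hint
  rw [← hM.map_sample_resid a] at hint'
  refine ⟨fun s => M.posDef_postCov s a, hM.condDistrib_action a,
    hM.condDistrib_dotProduct_action a (M.φ x), ?_, ?_, ?_⟩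
  · simp only [hsq]
    exact hint'.comp_measurable hSZ
  · exact (M.integrable_weightedNorm_postCov_sq a (M.φ x) _).comp_measurable hS
  · simp only [StructuredBandit.bayesianMSE, hsq]
    -- The error is integrated under the joint law of sample and residual; each fibre contributes
    -- the variance of a centred Gaussian.
    rw [← integral_map (φ := fun ω => (StructuredBandit.sample X A R ω,
        θ ω a - M.postMean (StructuredBandit.sample X A R ω) a))
      (f := fun p => ((M.φ x).ofLp ⬝ᵥ p.2.ofLp) ^ 2) hSZ.aemeasurable hint'.aestronglyMeasurable,
      hM.map_sample_resid a, Measure.integral_compProd hint]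
    simp only [M.integral_sq_dotProduct_residKernel]
    exact integral_map hS.aemeasurable
      (M.measurable_weightedNorm_postCov_sq a (M.φ x)).aestronglyMeasurable
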